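/- A target arena $\mathcal A=(V,V_P,E,T)$ is a finite directed graph $(V,E)$ that is bipartite between $V_P$ (Protagonist) and $V_N:=V\setminus V_P$ (Nature), with a set of targets $T\subseteq V_P$, such that every $u\in V_N$ has a non-empty set of successors $uE$; we assume $V_N\neq\emptyset$. For a family $\mu=(\mu_u)_{u\in V_N}$ of rational probability distributions $\mu_u$ on $uE$, let $\mathcal A_\mu$ be the Markov decision process with states $V_P\uplus\{\bot\}$, actions $V_N$, and transition probabilities $\delta(q\mid p,a)=\mu_a(q)$ if $(p,a),(a,q)\in E$, $\delta(\bot\mid p,a)=1$ if $(p,a)\notin E$, and $0$ otherwise. For $v\in V_P$ let $\mathrm{Val}^\mu(v)$ be the maximum, over the memoryless deterministic strategies $\sigma:V_P\uplus\{\bot\}\to V_N$, of the probability of eventually reaching $T$ from $v$ in the Markov chain induced by $\sigma$; for $u\in V_N$ let $\mathrm{Val}^\mu(u)=\sum_{v\in uE}\mu_u(v)\mathrm{Val}^\mu(v)$. For $v\in V$ and $W\subseteq V$ write $v\unlhd W$ if for every family $\mu$ of full-support distributions there is $w\in W$ with $\mathrm{Val}^\mu(v)\le\mathrm{Val}^\mu(w)$.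 For a partition $(S_i)_{0\le i\le k}$ of $V$ into non-empty sets let $S_i^+=\bigcup_{j>i}S_j$, $S_i^-=\bigcup_{j<i}S_j$, $D_i=\{v\in S_i\cap V_N : vE\cap S_i^-\ne\emptyset\}$ and $D=\bigcup_{0<i<k}D_i$. It is a drift partition if, for all $i\le k$, $vE\cap S_i^+=\emptyset$ for all $v\in S_i\cap V_P$, and $v\in D$ for all $v\in S_i\cap V_N$ with $vE\cap S_i^+\neq\emptyset$. **Corollary.** Consider the problem: given a target arena $\mathcal A$ (as an adjacency matrix), a non-empty set $W\subseteq V$ and a vertex $v\in V$, does $v\unlhd W$ hold? This problem is decidable and in $\mathsf{coNP}$. Moreover, $v\unlhd W$ fails if and only if there are a drift partition $(S_i)_{0\le i\le k}$ and a simple path $\pi$ from $v$ to $T$ with $\pi\subseteq S_k$, $T\subseteq S_k$ and $W\subseteq S_k^-$; every such pair has size polynomial in the size of the input, and whether a given pair, consisting of a partition $(S_i)_{0\le i\le k}$ of $V$ indexed by $0,\dots,k$ (blocks possibly empty) and a word of vertices, has these properties can be checked in polynomial time by a Turing machine. -/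

import Mathlib

open scoped ENNReal NNReal

noncomputable section

/-! ### Distributions, Markov chains, Markov decision processes -/

/-- Rational probability distributions on a finite set. -/
structure FinDist (S : Type) [Fintype S] where
  prob : S → ℚ≥0
  sum_eq_one : ∑ s, prob s = 1

/-- Full support. -/
def FinDist.FullSupport {S : Type} [Fintype S] (f : FinDist S) : Prop := ∀ s, 0 < f.prob s

/-- Finite Markov chains with set of states `Q`. -/
structure MarkovChain (Q : Type) [Fintype Q] where
  δ : Q → FinDist Q

namespace MarkovChain

variable {Q : Type} [Fintype Q]

/-- The probability `∏_{0 ≤ i < n} δ(p_i, p_{i+1})` of a run `p_0 … p_n`. -/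
def runProb (C : MarkovChain Q) : List Q → ℚ≥0
  | [] => 1
  | [_] => 1
  | p :: q :: ρ => (C.δ p).prob q * C.runProb (q :: ρ)

/-- The runs `q_0 … q_n ∈ (S \ T)^* T` with `n ≥ 1` that start in `q₀`. -/
def untilRuns (q₀ : Q) (S T : Set Q) : Set (List Q) :=
  {ρ | ρ.head? = some q₀ ∧
    ∃ (ρ' : List Q) (t : Q), ρ = ρ' ++ [t] ∧ ρ' ≠ [] ∧ (∀ q ∈ ρ', q ∈ S \ T) ∧ t ∈ T}

open scoped Classical in
/-- The probability of staying in states from `S` until `T` is reached. -/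
def untilProb (C : MarkovChain Q) (q₀ : Q) (S T : Set Q) : ℝ≥0∞ :=
  if q₀ ∈ T then 1 else ∑' ρ : untilRuns q₀ S T, ((C.runProb ρ.1 : ℝ≥0) : ℝ≥0∞)

/-- The probability of eventually reaching `T` from `q₀`. -/
def reachProb (C : MarkovChain Q) (q₀ : Q) (T : Set Q) : ℝ≥0∞ :=
  C.untilProb q₀ Set.univ T

end MarkovChain

/-- Finite Markov decision processes with states `Q`, actions `A` and target states `T`;
`(δ p a).prob q` is `δ(q | p, a)`. -/
structure MDP (Q A : Type) [Fintype Q] where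
  δ : Q → A → FinDist Q
  T : Set Q

/-- The Markov chain induced by a (memoryless deterministic) strategy `σ : Q → A`. -/
def MDP.inducedChain {Q A : Type} [Fintype Q] (M : MDP Q A) (σ : Q → A) : MarkovChain Q where
  δ q := M.δ q (σ q)

/-! ### Target arenas and the never-worse relation -/

/-- Target arenas `(V, V_P, E, T)`; the vertices of Nature are those outside `V_P`. -/
structure TargetArena (V : Type) where
  VP : Set V
  E : V → V → Prop
  T : Set V
  bipartite : ∀ u v, E u v → (u ∈ VP ↔ v ∉ VP)
  T_subset : T ⊆ VP
  exists_succ : ∀ u, u ∉ VP → ∃ v, E u v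

namespace TargetArena

variable {V : Type}

/-- The set `V_N` of the vertices of Nature. -/
def VN (A : TargetArena V) : Set V := A.VPᶜ

/-- The set `uE` of the successors of `u`. -/
def succ (A : TargetArena V) (u : V) : Set V := {v | A.E u v}

lemma succ_mem_VP (A : TargetArena V) (u : A.VN) (v : A.succ u) : (v : V) ∈ A.VP := by
  by_contra h
  exact u.2 ((A.bipartite _ _ v.2).2 h)

variable [Fintype V]

open scoped Classical in
/-- Families `μ = (μ_u)_{u ∈ V_N}` with `μ_u` a distribution on `uE`. -/
def NatureFamily (A : TargetArena V) : Type := ∀ u : A.VN, FinDist (A.succ u)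

open scoped Classical in
/-- All the distributions of the family have full support. -/
def NatureFamily.FullSupport {A : TargetArena V} (μ : A.NatureFamily) : Prop :=
  ∀ u, (μ u).FullSupport

open scoped Classical in
/-- The transition probabilities `δ(q | p, a)` of the MDP given by an arena and a family `μ`.
Its states are `V_P ⊎ {⊥}`, where `⊥` is `none`. -/
def transProb (A : TargetArena V) (μ : A.NatureFamily) :
    Option A.VP → A.VN → Option A.VP → ℚ≥0
  | some p, a, some q =>
      if h : A.E p a ∧ A.E a q then (μ a).prob ⟨q, h.2⟩ else 0
  | some p, a, none => if A.E p a then 0 else 1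
  | none, _, some _ => 0
  | none, _, none => 1

open scoped Classical in
lemma transProb_sum (A : TargetArena V) (μ : A.NatureFamily) (p : Option A.VP) (a : A.VN) :
    ∑ q, A.transProb μ p a q = 1 := by
  rw [Fintype.sum_option]
  cases p with
  | none => simp [transProb]
  | some p =>
    by_cases h : A.E p a
    · rw [← (μ a).sum_eq_one]
      simp only [transProb, h, if_true, true_and, zero_add]
      rw [← Finset.sum_filter_add_sum_filter_not Finset.univ (fun q : A.VP => A.E a q)]
      rw [Finset.sum_eq_zero (s := Finset.univ.filter fun q : A.VP => ¬ A.E a q), add_zero]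
      · refine Finset.sum_bij' (i := fun q hq => ⟨q.1, (Finset.mem_filter.1 hq).2⟩)
          (j := fun v _ => ⟨v.1, A.succ_mem_VP a v⟩) ?_ ?_ ?_ ?_ ?_
        · intro q hq; simp
        · intro v _; exact Finset.mem_filter.2 ⟨Finset.mem_univ _, v.2⟩
        · intro q hq; rfl
        · intro v _; rfl
        · intro q hq
          rw [dif_pos (Finset.mem_filter.1 hq).2]
      · intro q hq
        rw [dif_neg (Finset.mem_filter.1 hq).2]
    · simp [transProb, h]

open scoped Classical in
/-- The MDP induced by an arena and a family `μ`. -/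
def toMDP (A : TargetArena V) (μ : A.NatureFamily) : MDP (Option A.VP) A.VN where
  δ p a := ⟨A.transProb μ p a, A.transProb_sum μ p a⟩
  T := {q | ∃ t : A.VP, q = some t ∧ (t : V) ∈ A.T}

open scoped Classical in
/-- The value of a vertex of Protagonist: the maximum over all strategies of the probability of
reaching `T` in the induced chain (there are finitely many strategies, and at least one if
`V_N` is non-empty). -/
def valP (A : TargetArena V) (μ : A.NatureFamily) (v : A.VP) : ℝ≥0∞ :=
  ⨆ σ : Option A.VP → A.VN, ((A.toMDP μ).inducedChain σ).reachProb (some v) (A.toMDP μ).T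

open scoped Classical in
/-- The value `Val^μ(v)` of a vertex. -/
def val (A : TargetArena V) (μ : A.NatureFamily) (v : V) : ℝ≥0∞ :=
  if h : v ∈ A.VP then A.valP μ ⟨v, h⟩
  else ∑ w : A.succ v,
    (((μ ⟨v, h⟩).prob w : ℝ≥0) : ℝ≥0∞) * A.valP μ ⟨w, A.succ_mem_VP ⟨v, h⟩ w⟩

/-- The never-worse relation `v ⊴ W`. -/
def NeverWorse (A : TargetArena V) (v : V) (W : Set V) : Prop :=
  ∀ μ : A.NatureFamily, μ.FullSupport → ∃ w ∈ W, A.val μ v ≤ A.val μ w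

end TargetArena

/-! ### Drift partitions -/

/-- A partition `(S_i)_{0 ≤ i ≤ k}` is given by the function that maps each vertex to the index of
its block: `S_i` is `layer part i`. -/
def layer {V : Type} {k : ℕ} (part : V → Fin (k + 1)) (i : Fin (k + 1)) : Set V :=
  {u | part u = i}

/-- `S_i^+`, the union of the blocks `S_j` with `i < j`. -/
def layersAbove {V : Type} {k : ℕ} (part : V → Fin (k + 1)) (i : Fin (k + 1)) : Set V :=
  ⋃ j > i, layer part j

/-- `S_i^-`, the union of the blocks `S_j` with `j < i`. -/
def layersBelow {V : Type} {k : ℕ} (part : V → Fin (k + 1)) (i : Fin (k + 1)) : Set V :=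
  ⋃ j < i, layer part j

namespace TargetArena

variable {V : Type}

/-- The set `D` of drift vertices, the union of the `D_i` with `0 < i < k`. -/
def driftVertices (A : TargetArena V) {k : ℕ} (part : V → Fin (k + 1)) : Set V :=
  ⋃ i : Fin (k + 1), ⋃ _ : 0 < i ∧ i < Fin.last k,
    {v | v ∈ layer part i ∩ A.VN ∧ (A.succ v ∩ layersBelow part i).Nonempty}

/-- Drift partitions; surjectivity says that no block is empty. -/
structure IsDriftPartition (A : TargetArena V) {k : ℕ} (part : V → Fin (k + 1)) : Prop where
  surjective : Function.Surjective part
  protagonist : ∀ i, ∀ v ∈ layer part i ∩ A.VP, A.succ v ∩ layersAbove part i = ∅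
  nature : ∀ i, ∀ v ∈ layer part i ∩ A.VN,
    (A.succ v ∩ layersAbove part i).Nonempty → v ∈ A.driftVertices part

/-- Simple paths that start in `v` and end in the target set. -/
structure IsSimplePathToTarget (A : TargetArena V) (v : V) (π : List V) : Prop where
  chain : π.IsChain A.E
  simple : π.Nodup
  head : π.head? = some v
  last : ∃ t ∈ A.T, π.getLast? = some t

end TargetArena

/-- A candidate certificate on the vertex set `V`: an indexed family of `k + 1` pairwise disjoint
blocks covering `V`, and a word of vertices. -/
structure Certificate (V : Type) where
  k : ℕ
  part : V → Fin (k + 1)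
  path : List V

/-- The candidate is a drift partition `(S_i)_{0 ≤ i ≤ k}` together with a simple path `π` from `v`
to `T`, such that `π ⊆ S_k`, `T ⊆ S_k` and `W ⊆ S_k^-`. -/
structure Certificate.IsValid {V : Type} (c : Certificate V) (A : TargetArena V)
    (v : V) (W : Set V) : Prop where
  drift : A.IsDriftPartition c.part
  path_ok : A.IsSimplePathToTarget v c.path
  path_subset : ∀ u ∈ c.path, u ∈ layer c.part (Fin.last c.k)
  target_subset : A.T ⊆ layer c.part (Fin.last c.k)
  W_subset : W ⊆ layersBelow c.part (Fin.last c.k)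

/-! ### Decision problems

A decision problem is a set `L` of yes-instances in a type `α` of instances, which are presented to
machines as words through `enc : α → List Γ`. -/

/-- The problem `L` is decidable. -/
def DecidableProblem {α Γ : Type} [Primcodable Γ] (enc : α → List Γ) (L : Set α) : Prop :=
  ∃ f : List Γ → Bool, Computable f ∧ ∀ a, f (enc a) = true ↔ a ∈ L

/-- The problem `L` is decided by a Turing machine in polynomial time. -/
def InPolyTime {α Γ : Type} (enc : α → List Γ) (L : Set α) : Prop :=
  ∃ f : α → Bool, Nonempty (Turing.TM2ComputableInPolyTime enc Computability.encodeBool f) ∧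
    ∀ a, f a = true ↔ a ∈ L

/-- The encoding of a pair consisting of an instance and an arbitrary word. -/
def encodeWithWord {α Γ Δ : Type} (enc : α → List Γ) (x : α × List Δ) : List (Γ ⊕ Δ) :=
  (enc x.1).map Sum.inl ++ x.2.map Sum.inr

/-- The problem `L` is in NP: there are a polynomial-time decidable relation `R` between instances
and arbitrary words over a finite alphabet, and a polynomial `p`, such that `a ∈ L` if and only if
`R (a, y)` for some word `y` of length at most `p (|a|)`. -/
def InNP {α Γ : Type} (enc : α → List Γ) (L : Set α) : Prop :=
  ∃ (Δ : Type) (_ : Fintype Δ) (R : Set (α × List Δ)) (p : Polynomial ℕ),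
    InPolyTime (encodeWithWord enc) R ∧
    ∀ a, a ∈ L ↔ ∃ y : List Δ, y.length ≤ p.eval (enc a).length ∧ (a, y) ∈ R

/-- The problem `L` is in coNP. -/
def InCoNP {α Γ : Type} (enc : α → List Γ) (L : Set α) : Prop := InNP enc Lᶜ

/-! ### The problem of deciding the never-worse relation -/

/-- Instances: a target arena on the vertices `0, …, n - 1`, a non-empty set `W` and a vertex `v`.
Nature has at least one vertex, so that the induced MDPs have an action. -/
structure NWRInstance where
  n : ℕ
  arena : TargetArena (Fin n)
  VN_nonempty : arena.VN.Nonempty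
  W : Set (Fin n)
  W_nonempty : W.Nonempty
  v : Fin n

open scoped Classical in
/-- An instance is written as `n` rows over the alphabet of the two bits and the separator `none`.
The row of the vertex `u` tells whether `u ∈ V_P`, `u ∈ T`, `u ∈ W`, `u = v`, and goes on with the
row of `u` in the adjacency matrix. -/
def NWRInstance.encode (x : NWRInstance) : List (Option Bool) :=
  (List.ofFn fun u : Fin x.n =>
    [some (decide (u ∈ x.arena.VP)), some (decide (u ∈ x.arena.T)),
      some (decide (u ∈ x.W)), some (decide (u = x.v))] ++
    (List.ofFn fun w : Fin x.n => some (decide (x.arena.E u w))) ++ [none]).flatten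

/-- The problem: does `v ⊴ W` hold? -/
def NWRProblem : Set NWRInstance := {x | x.arena.NeverWorse x.v x.W}

/-- Unary notation, ended by the separator. -/
def unaryWord (m : ℕ) : List (Option Bool) := List.replicate m (some true) ++ [none]

/-- A candidate certificate is written as `k`, followed by the block index of each vertex, followed
by the vertices of the path, all in unary. -/
def Certificate.encode {n : ℕ} (c : Certificate (Fin n)) : List (Option Bool) :=
  unaryWord c.k ++ (List.ofFn fun u => unaryWord (c.part u)).flatten ++
    (c.path.map fun u => unaryWord u).flatten

/-- The encoding of a pair of an instance and a candidate certificate. -/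
def encodeWithCertificate (y : Σ x : NWRInstance, Certificate (Fin x.n)) :
    List (Option Bool ⊕ Option Bool) :=
  y.1.encode.map Sum.inl ++ y.2.encode.map Sum.inr

/-- The problem of checking a candidate certificate. -/
def CertificateCheck : Set (Σ x : NWRInstance, Certificate (Fin x.n)) :=
  {y | y.2.IsValid y.1.arena y.1.v y.1.W}

end

noncomputable section

/-!
For a fixed family `μ` the values are the least solution of the optimality equations. If a
full-support `μ` gives `v` a greater value than every vertex of `W`, then the level sets of the
values below `Val^μ(v)`, followed by one block with all the remaining vertices, form a drift
partition: the value of a vertex of Protagonist is at least that of each successor, and the value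
of a vertex of Nature is an average of those of its successors with positive weights. As the values
are the least solution, a level set of positive value that misses `T` has an edge to another vertex
of at least that value; hence `T` is reached from `v` without leaving the last block.

Conversely, given a drift partition and a path, let Nature move to a uniformly random successor
with a small probability `ε`, and otherwise to a favoured one: a successor in a lower block at the
drift vertices, the next vertex of the path on the path. Then a vertex of a block `S_i` with `i < k`
has value at most `i ε`, whereas `v` has value at least `1 - |π| ε`.

The conditions on a certificate are bounded first-order statements about the positions in the word
that encodes the instance and the certificate, with counting of letters. The truth of such a formula
is found by a stack machine with a polynomial number of passes over the word, and is primitive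
recursive in the word. Valid certificates have polynomial size, so that all candidates can be
searched.
-/

/-! ### Reachability in Markov chains -/

lemma tsum_list {α : Type*} (f : List α → ℝ≥0∞) :
    ∑' l, f l = f [] + ∑' a, ∑' l, f (a :: l) := by
  classical
  have cons_injective : Function.Injective fun p : α × List α => p.1 :: p.2 :=
    fun _ _ h => Prod.ext (List.cons.inj h).1 (List.cons.inj h).2
  rw [ENNReal.tsum_eq_add_tsum_ite [], ← ENNReal.tsum_prod (f := fun a l => f (a :: l)),
    ← cons_injective.tsum_eq]
  · simp
  · rintro (_ | ⟨a, l⟩) hl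
    · simp at hl
    · exact ⟨(a, l), rfl⟩

namespace MarkovChain

variable {Q : Type} {T : Set Q} {p q : Q} {ρ : List Q}

/-- The words that visit `T` exactly once, at their end. -/
def firstHits (T : Set Q) : Set (List Q) :=
  {ρ | ∃ (ρ' : List Q) (t : Q), ρ = ρ' ++ [t] ∧ (∀ q ∈ ρ', q ∉ T) ∧ t ∈ T}

lemma singleton_mem_firstHits : [p] ∈ firstHits T ↔ p ∈ T := by
  constructor
  · rintro ⟨ρ', t, h, -, ht⟩
    rcases ρ' with _ | ⟨a, l⟩ <;> simp_all
  · exact fun hp => ⟨[], p, by simp [hp]⟩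

lemma cons_cons_mem_firstHits :
    p :: q :: ρ ∈ firstHits T ↔ p ∉ T ∧ q :: ρ ∈ firstHits T := by
  constructor
  · rintro ⟨_ | ⟨a, l⟩, t, h, hl, ht⟩
    · simp at h
    · obtain ⟨rfl, hρ⟩ := List.cons.inj h
      exact ⟨hl _ List.mem_cons_self, l, t, hρ, fun b hb => hl b (List.mem_cons_of_mem _ hb), ht⟩
  · rintro ⟨hp, ρ', t, h, hl, ht⟩
    exact ⟨p :: ρ', t, by rw [h, List.cons_append], List.forall_mem_cons.2 ⟨hp, hl⟩, ht⟩

lemma untilRuns_univ (hp : p ∉ T) :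
    untilRuns p Set.univ T = Set.range (List.cons p) ∩ firstHits T := by
  ext ρ
  constructor
  · rintro ⟨hhead, ρ', t, h, -, hρ', ht⟩
    obtain ⟨l, rfl⟩ := List.head?_eq_some_iff.1 hhead
    exact ⟨⟨l, rfl⟩, ρ', t, h, fun q hq => (hρ' q hq).2, ht⟩
  · rintro ⟨⟨l, rfl⟩, ρ', t, h, hρ', ht⟩
    refine ⟨rfl, ρ', t, h, ?_, fun q hq => ⟨Set.mem_univ q, hρ' q hq⟩, ht⟩
    rintro rfl
    exact hp ((List.cons.inj h).1 ▸ ht)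

variable [Fintype Q] (C : MarkovChain Q)

/-- The transition probabilities as real numbers. -/
def step (p q : Q) : ℝ := (C.δ p).prob q

/-- The transition probabilities as extended nonnegative real numbers. -/
def estep (p q : Q) : ℝ≥0∞ := (((C.δ p).prob q : ℝ≥0) : ℝ≥0∞)

lemma step_nonneg (p q : Q) : 0 ≤ C.step p q := NNRat.cast_nonneg _

lemma sum_step (p : Q) : ∑ q, C.step p q = 1 := by
  simp only [step, ← NNRat.cast_sum, (C.δ p).sum_eq_one, NNRat.cast_one]

lemma ofReal_step (p q : Q) : ENNReal.ofReal (C.step p q) = C.estep p q := by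
  rw [step, estep, ← ENNReal.ofReal_coe_nnreal]
  norm_cast

lemma ofReal_sum_step_mul {x : Q → ℝ} (hx : ∀ q, 0 ≤ x q) (p : Q) :
    ENNReal.ofReal (∑ q, C.step p q * x q) = ∑ q, C.estep p q * ENNReal.ofReal (x q) := by
  rw [ENNReal.ofReal_sum_of_nonneg fun q _ => mul_nonneg (C.step_nonneg p q) (hx q)]
  simp only [ENNReal.ofReal_mul (C.step_nonneg p _), ofReal_step]

lemma eq_of_le_sum_step {x : Q → ℝ} {m : ℝ} (hx : ∀ q, x q ≤ m)
    (hm : m ≤ ∑ q, C.step p q * x q) (hq : 0 < C.step p q) : x q = m := by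
  by_contra hne
  have : ∑ r, C.step p r * x r < ∑ r, C.step p r * m :=
    Finset.sum_lt_sum (fun r _ => mul_le_mul_of_nonneg_left (hx r) (C.step_nonneg p r))
      ⟨q, Finset.mem_univ q, mul_lt_mul_of_pos_left ((hx q).lt_of_ne hne) hq⟩
  rw [← Finset.sum_mul, C.sum_step, one_mul] at this
  exact this.not_ge hm

/-- The probability of a run that visits `T` exactly once, at its end, and `0` for the other
runs. -/
def hitProb (T : Set Q) : List Q → ℝ≥0∞ :=
  (firstHits T).indicator fun ρ => ((C.runProb ρ : ℝ≥0) : ℝ≥0∞)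

lemma hitProb_singleton_of_mem (hp : p ∈ T) : C.hitProb T [p] = 1 := by
  simp [hitProb, singleton_mem_firstHits.2 hp, runProb]

lemma hitProb_singleton_of_notMem (hp : p ∉ T) : C.hitProb T [p] = 0 :=
  Set.indicator_of_notMem (mt singleton_mem_firstHits.1 hp) _

lemma hitProb_cons_cons_of_mem (hp : p ∈ T) : C.hitProb T (p :: q :: ρ) = 0 :=
  Set.indicator_of_notMem (fun h => (cons_cons_mem_firstHits.1 h).1 hp) _

lemma hitProb_cons_cons_of_notMem (hp : p ∉ T) :
    C.hitProb T (p :: q :: ρ) = C.estep p q * C.hitProb T (q :: ρ) := by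
  by_cases hρ : q :: ρ ∈ firstHits T
  · rw [hitProb, Set.indicator_of_mem (cons_cons_mem_firstHits.2 ⟨hp, hρ⟩),
      Set.indicator_of_mem hρ, runProb, estep, NNRat.cast_mul, ENNReal.coe_mul]
  · rw [hitProb, Set.indicator_of_notMem fun h => hρ (cons_cons_mem_firstHits.1 h).2,
      Set.indicator_of_notMem hρ, mul_zero]

lemma reachProb_of_mem (hp : p ∈ T) : C.reachProb p T = 1 := by
  simp [reachProb, untilProb, hp]

lemma reachProb_eq_tsum_hitProb (T : Set Q) (p : Q) :
    C.reachProb p T = ∑' ρ, C.hitProb T (p :: ρ) := by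
  by_cases hp : p ∈ T
  · rw [reachProb_of_mem C hp, tsum_eq_single [], hitProb_singleton_of_mem C hp]
    rintro (_ | ⟨q, ρ⟩) hρ
    · exact absurd rfl hρ
    · exact C.hitProb_cons_cons_of_mem hp
  · rw [reachProb, untilProb, if_neg hp, tsum_subtype (untilRuns p Set.univ T)
      fun ρ => ((C.runProb ρ : ℝ≥0) : ℝ≥0∞), untilRuns_univ hp, ← Set.indicator_indicator,
      ← List.cons_injective.tsum_eq Set.support_indicator_subset]
    exact tsum_congr fun ρ => Set.indicator_of_mem (Set.mem_range_self ρ) _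

lemma reachProb_of_notMem (hp : p ∉ T) :
    C.reachProb p T = ∑ q, C.estep p q * C.reachProb q T := by
  simp only [reachProb_eq_tsum_hitProb]
  rw [tsum_list, hitProb_singleton_of_notMem C hp, zero_add, tsum_fintype]
  simp only [hitProb_cons_cons_of_notMem C hp, ENNReal.tsum_mul_left]

lemma tsum_hitProb_length_lt_le {x : Q → ℝ≥0∞} (hT : ∀ p ∈ T, 1 ≤ x p)
    (hx : ∀ p ∉ T, ∑ q, C.estep p q * x q ≤ x p) (N : ℕ) (p : Q) :
    ∑' ρ : List Q, (if ρ.length < N then C.hitProb T (p :: ρ) else 0) ≤ x p := by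
  induction N generalizing p with
  | zero => simp
  | succ N ih =>
    rw [tsum_list, tsum_fintype]
    by_cases hp : p ∈ T
    · simpa [hitProb_singleton_of_mem C hp, hitProb_cons_cons_of_mem C hp] using hT p hp
    · refine le_trans ?_ (hx p hp)
      simp only [List.length_nil, Nat.zero_lt_succ, if_true, hitProb_singleton_of_notMem C hp,
        zero_add, List.length_cons, Nat.add_lt_add_iff_right, hitProb_cons_cons_of_notMem C hp,
        ← mul_ite_zero, ENNReal.tsum_mul_left]
      gcongr with q
      exact ih q

lemma reachProb_le {x : Q → ℝ≥0∞} (hT : ∀ p ∈ T, 1 ≤ x p)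
    (hx : ∀ p ∉ T, ∑ q, C.estep p q * x q ≤ x p) (p : Q) : C.reachProb p T ≤ x p := by
  rw [reachProb_eq_tsum_hitProb, ENNReal.tsum_eq_iSup_sum]
  refine iSup_le fun s => ?_
  refine le_trans ?_ (C.tsum_hitProb_length_lt_le hT hx (s.sup List.length + 1) p)
  refine le_trans (Finset.sum_le_sum fun ρ hρ => ?_) (ENNReal.sum_le_tsum s)
  rw [if_pos (Nat.lt_succ_of_le (Finset.le_sup (f := List.length) hρ))]

lemma reachProb_le_one (T : Set Q) (p : Q) : C.reachProb p T ≤ 1 :=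
  C.reachProb_le (x := fun _ => 1) (fun _ _ => le_rfl)
    (fun p _ => by
      have := C.ofReal_sum_step_mul (x := fun _ => 1) (fun _ => zero_le_one) p
      simpa [C.sum_step] using this.ge) p

/-- The probability of eventually reaching `T`, as a real number. -/
def reachReal (T : Set Q) (p : Q) : ℝ := (C.reachProb p T).toReal

lemma ofReal_reachReal (T : Set Q) (p : Q) :
    ENNReal.ofReal (C.reachReal T p) = C.reachProb p T :=
  ENNReal.ofReal_toReal (ne_top_of_le_ne_top ENNReal.one_ne_top (C.reachProb_le_one T p))

lemma reachReal_nonneg (T : Set Q) (p : Q) : 0 ≤ C.reachReal T p :=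
  ENNReal.toReal_nonneg

lemma reachReal_le_one (T : Set Q) (p : Q) : C.reachReal T p ≤ 1 :=
  ENNReal.toReal_le_of_le_ofReal zero_le_one (by simpa using C.reachProb_le_one T p)

lemma reachReal_of_mem (hp : p ∈ T) : C.reachReal T p = 1 := by
  rw [reachReal, C.reachProb_of_mem hp, ENNReal.toReal_one]

lemma reachReal_of_notMem (hp : p ∉ T) :
    C.reachReal T p = ∑ q, C.step p q * C.reachReal T q := by
  have sum_nonneg : 0 ≤ ∑ q, C.step p q * C.reachReal T q :=
    Finset.sum_nonneg fun q _ => mul_nonneg (C.step_nonneg p q) (C.reachReal_nonneg T q)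
  rw [← ENNReal.ofReal_eq_ofReal_iff (C.reachReal_nonneg T p) sum_nonneg,
    C.ofReal_sum_step_mul (C.reachReal_nonneg T)]
  simp only [ofReal_reachReal]
  exact C.reachProb_of_notMem hp

lemma reachReal_le {x : Q → ℝ} (h0 : ∀ p, 0 ≤ x p) (hT : ∀ p ∈ T, 1 ≤ x p)
    (hx : ∀ p ∉ T, ∑ q, C.step p q * x q ≤ x p) (p : Q) : C.reachReal T p ≤ x p := by
  refine ENNReal.toReal_le_of_le_ofReal (h0 p)
    (C.reachProb_le (x := fun p => ENNReal.ofReal (x p)) (fun p hp => ?_) (fun p hp => ?_) p)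
  · simpa using hT p hp
  · rw [← C.ofReal_sum_step_mul h0]
    exact ENNReal.ofReal_le_ofReal (hx p hp)

/-- Sets of states that do not meet `T` and cannot be left. -/
structure IsTrap (T M : Set Q) : Prop where
  notMem : ∀ p ∈ M, p ∉ T
  closed : ∀ p ∈ M, ∀ q, 0 < C.step p q → q ∈ M

variable {C}

lemma IsTrap.reachReal_eq_zero {M : Set Q} (hM : C.IsTrap T M) (hp : p ∈ M) :
    C.reachReal T p = 0 := by
  classical
  refine le_antisymm ?_ (C.reachReal_nonneg T p)
  have hle := C.reachReal_le (T := T) (x := Mᶜ.indicator 1)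
    (fun q => Set.indicator_nonneg (fun _ _ => zero_le_one) q)
    (fun q hq => by rw [Set.indicator_of_mem (show q ∈ Mᶜ from fun h => hM.notMem q h hq)]; rfl)
    (fun q _ => ?_) p
  · rwa [Set.indicator_of_notMem (not_not_intro hp)] at hle
  · by_cases hq : q ∈ M
    · refine (Finset.sum_eq_zero fun r _ => ?_).trans_le (by simp [hq])
      rcases (C.step_nonneg q r).eq_or_lt with h | h
      · rw [← h, zero_mul]
      · simp [hM.closed q hq r h]
    · rw [Set.indicator_of_mem (by exact hq), Pi.one_apply, ← C.sum_step q]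
      refine Finset.sum_le_sum fun r _ => mul_le_of_le_one_right (C.step_nonneg q r) ?_
      exact Set.indicator_le_self' (fun _ _ => zero_le_one) r

/-- The trap is the set of states at which `x - C.reachReal T` is maximal. -/
lemma exists_isTrap_of_reachReal_lt {x : Q → ℝ} (hT : ∀ p ∈ T, x p ≤ 1)
    (hx : ∀ p ∉ T, x p ≤ ∑ q, C.step p q * x q) (hq : C.reachReal T q < x q) :
    ∃ M : Set Q, M.Nonempty ∧ C.IsTrap T M ∧ ∃ d > 0, ∀ p ∈ M, x p = d := by
  have : Nonempty Q := ⟨q⟩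
  obtain ⟨m, hm⟩ := Finite.exists_max fun p => x p - C.reachReal T p
  set d := x m - C.reachReal T m with hd
  have d_pos : 0 < d := (sub_pos.2 hq).trans_le (hm q)
  have trap : C.IsTrap T {p | x p - C.reachReal T p = d} := by
    have notMem : ∀ p ∈ {p | x p - C.reachReal T p = d}, p ∉ T := fun p hp hpT => by
      have hp : x p - C.reachReal T p = d := hp
      have := hT p hpT
      have := C.reachReal_of_mem hpT
      linarith
    refine ⟨notMem, fun p hp r hr => C.eq_of_le_sum_step hm ?_ hr⟩
    calc d = x p - C.reachReal T p := hp.symm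
      _ ≤ ∑ r, C.step p r * x r - ∑ r, C.step p r * C.reachReal T r :=
        sub_le_sub (hx p (notMem p hp)) (C.reachReal_of_notMem (notMem p hp)).ge
      _ = ∑ r, C.step p r * (x r - C.reachReal T r) := by
        simp only [mul_sub, Finset.sum_sub_distrib]
  refine ⟨_, ⟨m, hd.symm⟩, trap, d, d_pos, fun p hp => ?_⟩
  have : x p - C.reachReal T p = d := hp
  rwa [trap.reachReal_eq_zero hp, sub_zero] at this

end MarkovChain

/-! ### Optimal strategies -/

namespace MDP

variable {Q A : Type} [Fintype Q] (M : MDP Q A) {σ : Q → A} {p : Q} {a : A}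

/-- The transition probabilities as real numbers. -/
def step (p : Q) (a : A) (q : Q) : ℝ := (M.δ p a).prob q

/-- The probability of eventually reaching the target states under a strategy. -/
def reach (σ : Q → A) (p : Q) : ℝ := (M.inducedChain σ).reachReal M.T p

lemma step_nonneg (p : Q) (a : A) (q : Q) : 0 ≤ M.step p a q := NNRat.cast_nonneg _

lemma reach_of_notMem (σ : Q → A) (hp : p ∉ M.T) :
    M.reach σ p = ∑ q, M.step p (σ p) q * M.reach σ q :=
  (M.inducedChain σ).reachReal_of_notMem hp

lemma reach_le {x : Q → ℝ} (h0 : ∀ p, 0 ≤ x p) (hT : ∀ p ∈ M.T, 1 ≤ x p)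
    (hx : ∀ p ∉ M.T, ∀ a, ∑ q, M.step p a q * x q ≤ x p) (τ : Q → A) (p : Q) :
    M.reach τ p ≤ x p :=
  (M.inducedChain τ).reachReal_le h0 hT (fun p hp => hx p hp (τ p)) p

/-- The old values are subharmonic for the new strategy. A trap of the new strategy on which they
are a positive constant contains no strict improvement, so the two strategies agree on it and it
is a trap of the old strategy, whose values vanish there. -/
lemma reach_le_reach_update [DecidableEq Q] (hp : p ∉ M.T)
    (h : M.reach σ p < ∑ q, M.step p a q * M.reach σ q) (q : Q) :
    M.reach σ q ≤ M.reach (Function.update σ p a) q := by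
  set τ := Function.update σ p a
  have step_self (r : Q) : (M.inducedChain τ).step p r = M.step p a r := by
    simp [τ, inducedChain, MarkovChain.step, step]
  have step_of_ne {r : Q} (hr : r ≠ p) (s : Q) :
      (M.inducedChain τ).step r s = (M.inducedChain σ).step r s := by
    simp [τ, inducedChain, MarkovChain.step, hr]
  by_contra! hlt
  obtain ⟨N, ⟨m, hm⟩, trap, d, d_pos, hd⟩ :=
    (M.inducedChain τ).exists_isTrap_of_reachReal_lt (x := M.reach σ)
      (fun r _ => (M.inducedChain σ).reachReal_le_one M.T r)
      (fun r hr => by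
        rcases eq_or_ne r p with rfl | hrp
        · simpa only [step_self] using h.le
        · simp only [step_of_ne hrp]
          exact (M.reach_of_notMem σ hr).le) hlt
  have p_notMem : p ∉ N := fun hpN => by
    have : ∑ r, M.step p a r * M.reach σ r = ∑ r, (M.inducedChain τ).step p r * d :=
      Finset.sum_congr rfl fun r _ => by
        rw [step_self]
        rcases (M.step_nonneg p a r).eq_or_lt with h0 | h0
        · rw [← h0, zero_mul, zero_mul]
        · rw [hd r (trap.closed p hpN r (by rwa [step_self]))]
    rw [this, ← Finset.sum_mul, MarkovChain.sum_step, one_mul, hd p hpN] at h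
    exact h.false
  have trap_σ : (M.inducedChain σ).IsTrap M.T N :=
    ⟨trap.notMem, fun r hr s hs => trap.closed r hr s <| by
      rwa [step_of_ne fun h => p_notMem (h ▸ hr)]⟩
  exact d_pos.ne ((trap_σ.reachReal_eq_zero hm).symm.trans (hd m hm))

/-- The optimality equation: no action is better than the one chosen by `σ`. -/
def IsOptimal (σ : Q → A) : Prop :=
  ∀ p ∉ M.T, ∀ a, ∑ q, M.step p a q * M.reach σ q ≤ M.reach σ p

lemma exists_isOptimal [Finite A] [Nonempty A] : ∃ σ, M.IsOptimal σ := by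
  classical
  obtain ⟨σ, hσ⟩ := Finite.exists_max fun σ : Q → A => ∑ p, M.reach σ p
  refine ⟨σ, fun p hp a => ?_⟩
  by_contra! h
  have hle := M.reach_le_reach_update hp h
  refine (hσ (Function.update σ p a)).not_gt
    (Finset.sum_lt_sum (fun q _ => hle q) ⟨p, Finset.mem_univ p, ?_⟩)
  calc M.reach σ p < ∑ q, M.step p a q * M.reach σ q := h
    _ ≤ ∑ q, M.step p a q * M.reach (Function.update σ p a) q :=
      Finset.sum_le_sum fun q _ => mul_le_mul_of_nonneg_left (hle q) (M.step_nonneg p a q)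
    _ = M.reach (Function.update σ p a) p := by
      rw [M.reach_of_notMem _ hp, Function.update_self]

variable {M}

lemma IsOptimal.reach_le (hσ : M.IsOptimal σ) (τ : Q → A) (p : Q) : M.reach τ p ≤ M.reach σ p :=
  M.reach_le ((M.inducedChain σ).reachReal_nonneg M.T)
    (fun _ hp => ((M.inducedChain σ).reachReal_of_mem hp).ge) hσ τ p

end MDP

/-! ### The values of a target arena -/

namespace TargetArena

section Expect

variable {V : Type} [Fintype V] (A : TargetArena V) (μ : A.NatureFamily) (u : A.VN) {f g : V → ℝ}

open scoped Classical in
/-- The expectation of `f` after Nature's move in `u`. -/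
def expect (f : V → ℝ) : ℝ := ∑ w : A.succ u, (μ u).prob w * f w

lemma expect_mono (h : ∀ w, A.E u w → f w ≤ g w) : A.expect μ u f ≤ A.expect μ u g :=
  Finset.sum_le_sum fun w _ => mul_le_mul_of_nonneg_left (h w w.2) (NNRat.cast_nonneg _)

lemma expect_const (c : ℝ) : A.expect μ u (fun _ => c) = c := by
  classical
  rw [expect, ← Finset.sum_mul, ← NNRat.cast_sum, (μ u).sum_eq_one, NNRat.cast_one, one_mul]

lemma expect_le_of_forall_le {c : ℝ} (h : ∀ w, A.E u w → f w ≤ c) : A.expect μ u f ≤ c :=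
  (A.expect_mono μ u h).trans_eq (A.expect_const μ u c)

variable {A μ u}

lemma expect_lt_expect (hμ : μ.FullSupport) (h : ∀ w, A.E u w → f w ≤ g w) {w : V}
    (hw : A.E u w) (hlt : f w < g w) : A.expect μ u f < A.expect μ u g := by
  classical
  exact Finset.sum_lt_sum
    (fun w _ => mul_le_mul_of_nonneg_left (h w w.2) (NNRat.cast_nonneg _))
    ⟨⟨w, hw⟩, Finset.mem_univ _, mul_lt_mul_of_pos_left hlt (NNRat.cast_pos.2 (hμ u ⟨w, hw⟩))⟩

end Expect

section ToMDP

variable {V : Type} [Fintype V] {A : TargetArena V} (μ : A.NatureFamily) {p : A.VP} {a : A.VN}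

open scoped Classical in
lemma some_mem_toMDP_T : some p ∈ (A.toMDP μ).T ↔ (p : V) ∈ A.T := by
  simp [toMDP]

open scoped Classical in
lemma none_notMem_toMDP_T : none ∉ (A.toMDP μ).T := by
  simp [toMDP]

open scoped Classical in
lemma toMDP_sum_step_of_E (h : A.E p a) (x : V → ℝ) :
    ∑ q, (A.toMDP μ).step (some p) a q * q.elim 0 (fun v => x v) = A.expect μ a x := by
  rw [Fintype.sum_option, Option.elim_none, mul_zero, zero_add]
  refine (Fintype.sum_of_injective (fun w : A.succ a => (⟨w, A.succ_mem_VP a w⟩ : A.VP))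
    (fun v w hvw => Subtype.ext (Subtype.mk.inj hvw)) _ _ (fun q hq => ?_) fun w => ?_).symm
  · have not_E : ¬ A.E a q := fun hE => hq ⟨⟨q, hE⟩, rfl⟩
    simp [MDP.step, toMDP, transProb, not_E]
  · have hw : A.E a w := w.2
    simp [MDP.step, toMDP, transProb, h, hw]

open scoped Classical in
lemma toMDP_sum_step_of_not_E (h : ¬ A.E p a) (x : V → ℝ) :
    ∑ q, (A.toMDP μ).step (some p) a q * q.elim 0 (fun v => x v) = 0 := by
  simp [Fintype.sum_option, MDP.step, toMDP, transProb, h]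

open scoped Classical in
lemma toMDP_sum_step_none (a : A.VN) (x : V → ℝ) :
    ∑ q, (A.toMDP μ).step none a q * q.elim 0 (fun v => x v) = 0 := by
  simp [Fintype.sum_option, MDP.step, toMDP, transProb]

open scoped Classical in
lemma toMDP_reach_none (σ : Option A.VP → A.VN) : (A.toMDP μ).reach σ none = 0 :=
  MarkovChain.IsTrap.reachReal_eq_zero (M := {none})
    ⟨by rintro _ rfl; exact none_notMem_toMDP_T μ, by
      rintro _ rfl (_ | q) hq
      · rfl
      · simp [MarkovChain.step, MDP.inducedChain, toMDP, transProb] at hq⟩ rfl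

end ToMDP

variable {V : Type} [Fintype V] {A : TargetArena V} (μ : A.NatureFamily)

/-- The value of a vertex as a real number. -/
def realVal (v : V) : ℝ := (A.val μ v).toReal

lemma realVal_nonneg (v : V) : 0 ≤ realVal μ v := ENNReal.toReal_nonneg

lemma val_of_mem_VP (p : A.VP) : A.val μ p = A.valP μ p := dif_pos p.2

lemma valP_ne_top (p : A.VP) : A.valP μ p ≠ ∞ := by
  classical
  exact ne_top_of_le_ne_top ENNReal.one_ne_top <|
    iSup_le fun _ => MarkovChain.reachProb_le_one _ _ _

open scoped Classical in
lemma val_of_mem_VN (u : A.VN) : A.val μ u =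
    ∑ w : A.succ u, (((μ u).prob w : ℝ≥0) : ℝ≥0∞) * A.valP μ ⟨w, A.succ_mem_VP u w⟩ :=
  dif_neg u.2

lemma val_ne_top (v : V) : A.val μ v ≠ ∞ := by
  classical
  by_cases hv : v ∈ A.VP
  · exact (val_of_mem_VP μ ⟨v, hv⟩).trans_ne (valP_ne_top μ _)
  · rw [val_of_mem_VN μ ⟨v, hv⟩]
    exact ENNReal.sum_ne_top.2 fun w _ => ENNReal.mul_ne_top ENNReal.coe_ne_top (valP_ne_top μ _)

lemma realVal_le_realVal {v w : V} : realVal μ v ≤ realVal μ w ↔ A.val μ v ≤ A.val μ w :=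
  ENNReal.toReal_le_toReal (val_ne_top μ v) (val_ne_top μ w)

lemma realVal_nature (u : A.VN) : realVal μ u = A.expect μ u (realVal μ) := by
  classical
  rw [realVal, val_of_mem_VN, ENNReal.toReal_sum fun w _ =>
    ENNReal.mul_ne_top ENNReal.coe_ne_top (valP_ne_top μ _)]
  refine Finset.sum_congr rfl fun w _ => ?_
  rw [ENNReal.toReal_mul, realVal, val_of_mem_VP μ ⟨w, A.succ_mem_VP u w⟩, ENNReal.coe_toReal]
  norm_cast

variable [Nonempty A.VN]

open scoped Classical in
lemma exists_isOptimal_realVal : ∃ σ, (A.toMDP μ).IsOptimal σ ∧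
    ∀ p : A.VP, realVal μ p = (A.toMDP μ).reach σ (some p) := by
  obtain ⟨σ, hσ⟩ := (A.toMDP μ).exists_isOptimal
  refine ⟨σ, hσ, fun p => congrArg ENNReal.toReal ?_⟩
  refine (val_of_mem_VP μ p).trans (le_antisymm (iSup_le fun τ => ?_) (le_iSup_of_le σ le_rfl))
  rw [← MarkovChain.ofReal_reachReal, ← MarkovChain.ofReal_reachReal]
  exact ENNReal.ofReal_le_ofReal (hσ.reach_le τ (some p))

lemma realVal_le_one (v : V) : realVal μ v ≤ 1 := by
  classical
  have le_one_of_mem (p : A.VP) : realVal μ p ≤ 1 := by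
    obtain ⟨σ, -, hσ⟩ := exists_isOptimal_realVal μ
    exact (hσ p).trans_le (MarkovChain.reachReal_le_one _ _ _)
  by_cases hv : v ∈ A.VP
  · exact le_one_of_mem ⟨v, hv⟩
  · refine (realVal_nature μ ⟨v, hv⟩).trans_le (A.expect_le_of_forall_le μ _ fun w hw => ?_)
    exact le_one_of_mem ⟨w, A.succ_mem_VP ⟨v, hv⟩ ⟨w, hw⟩⟩

lemma realVal_target {t : V} (ht : t ∈ A.T) : realVal μ t = 1 := by
  classical
  obtain ⟨σ, -, hσ⟩ := exists_isOptimal_realVal μ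
  rw [hσ ⟨t, A.T_subset ht⟩]
  exact MarkovChain.reachReal_of_mem _ ((some_mem_toMDP_T μ).2 ht)

omit [Fintype V] [Nonempty A.VN] in
lemma mem_VN_of_E {p u : V} (hp : p ∈ A.VP) (h : A.E p u) : u ∈ A.VN :=
  (A.bipartite p u h).1 hp

lemma realVal_le_of_E {p u : V} (hp : p ∈ A.VP) (h : A.E p u) : realVal μ u ≤ realVal μ p := by
  classical
  by_cases hpT : p ∈ A.T
  · exact (realVal_le_one μ u).trans_eq (realVal_target μ hpT).symm
  obtain ⟨σ, optimal, hσ⟩ := exists_isOptimal_realVal μ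
  have reach_eq (q : Option A.VP) :
      (A.toMDP μ).reach σ q = q.elim 0 (fun v => realVal μ v) := by
    rcases q with _ | q
    · exact toMDP_reach_none μ σ
    · exact (hσ q).symm
  have hle := optimal (some ⟨p, hp⟩) (mt (some_mem_toMDP_T μ).1 hpT) ⟨u, mem_VN_of_E hp h⟩
  simp only [reach_eq] at hle
  rwa [toMDP_sum_step_of_E μ h, ← realVal_nature] at hle

lemma realVal_le {x : V → ℝ} (h0 : ∀ v, 0 ≤ x v) (hT : ∀ t ∈ A.T, 1 ≤ x t)
    (hP : ∀ p ∈ A.VP, p ∉ A.T → ∀ u, A.E p u → x u ≤ x p)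
    (hN : ∀ u : A.VN, A.expect μ u x ≤ x u) (v : V) : realVal μ v ≤ x v := by
  classical
  obtain ⟨σ, -, hσ⟩ := exists_isOptimal_realVal μ
  have le_of_mem (p : A.VP) : realVal μ p ≤ x p := by
    refine (hσ p).trans_le ((A.toMDP μ).reach_le (x := fun q => q.elim 0 fun v => x v)
      ?_ ?_ ?_ σ (some p))
    · rintro (_ | q)
      · exact le_rfl
      · exact h0 q
    · rintro (_ | q) hq
      · exact absurd hq (none_notMem_toMDP_T μ)
      · exact hT q ((some_mem_toMDP_T μ).1 hq)
    · rintro (_ | q) hq a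
      · exact (toMDP_sum_step_none μ a x).le
      · by_cases hE : A.E q a
        · rw [toMDP_sum_step_of_E μ hE]
          exact (hN a).trans (hP q q.2 (mt (some_mem_toMDP_T μ).2 hq) a hE)
        · exact (toMDP_sum_step_of_not_E μ hE x).trans_le (h0 q)
  by_cases hv : v ∈ A.VP
  · exact le_of_mem ⟨v, hv⟩
  · refine (realVal_nature μ ⟨v, hv⟩).trans_le (le_trans (A.expect_mono μ _ fun w hw => ?_) (hN _))
    exact le_of_mem ⟨w, A.succ_mem_VP ⟨v, hv⟩ ⟨w, hw⟩⟩

end TargetArena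

/-! ### Drift partitions and paths -/

section Layers

variable {V : Type} {k : ℕ} {part : V → Fin (k + 1)} {i : Fin (k + 1)} {v : V}

@[simp] lemma mem_layer : v ∈ layer part i ↔ part v = i := Iff.rfl

@[simp] lemma mem_layersAbove : v ∈ layersAbove part i ↔ i < part v := by
  simp [layersAbove]

@[simp] lemma mem_layersBelow : v ∈ layersBelow part i ↔ part v < i := by
  simp [layersBelow]

lemma TargetArena.mem_driftVertices {A : TargetArena V} :
    v ∈ A.driftVertices part ↔
      (0 < part v ∧ part v < Fin.last k) ∧ v ∉ A.VP ∧ ∃ w, A.E v w ∧ part w < part v := by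
  simp only [TargetArena.driftVertices, Set.mem_iUnion, Set.mem_ofPred_eq, Set.mem_inter_iff,
    mem_layer, Set.Nonempty, mem_layersBelow, TargetArena.succ, TargetArena.VN, Set.mem_compl_iff]
  constructor
  · rintro ⟨i, hi, ⟨rfl, h1⟩, h2⟩
    exact ⟨hi, h1, h2⟩
  · rintro ⟨h1, h2, h3⟩
    exact ⟨part v, h1, ⟨rfl, h2⟩, h3⟩

lemma TargetArena.isDriftPartition_iff {A : TargetArena V} :
    A.IsDriftPartition part ↔ Function.Surjective part ∧
      ∀ u w, A.E u w → part u < part w → u ∉ A.VP ∧ ∃ w', A.E u w' ∧ part w' < part u := by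
  constructor
  · refine fun ⟨surjective, protagonist, nature⟩ => ⟨surjective, fun u w hE hlt => ?_⟩
    have hw : w ∈ A.succ u ∩ layersAbove part (part u) := ⟨hE, mem_layersAbove.2 hlt⟩
    have hu : u ∉ A.VP := fun hu =>
      Set.eq_empty_iff_forall_notMem.1 (protagonist _ u ⟨rfl, hu⟩) w hw
    exact (mem_driftVertices.1 (nature _ u ⟨rfl, hu⟩ ⟨w, hw⟩)).2
  · refine fun ⟨surjective, drift⟩ => ⟨surjective, ?_, ?_⟩
    · rintro _ u ⟨rfl, hu⟩
      exact Set.eq_empty_of_forall_notMem fun w ⟨hE, hw⟩ =>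
        (drift u w hE (mem_layersAbove.1 hw)).1 hu
    · rintro _ u ⟨rfl, -⟩ ⟨w, hE, hw⟩
      rw [mem_layersAbove] at hw
      obtain ⟨hu, w', hE', hw'⟩ := drift u w hE hw
      exact mem_driftVertices.2 ⟨⟨hw'.pos, hw.trans_le (Fin.le_last _)⟩, hu, w', hE', hw'⟩

end Layers

section Levels

variable {V : Type} {α : Type*} [Fintype V] [LinearOrder α] (y : V → α) (c : α)

/-- The values of `y` below `c`. -/
def levelsBelow : Finset α := (Finset.univ.image y).filter (· < c)

@[simp] lemma mem_levelsBelow {a : α} : a ∈ levelsBelow y c ↔ (∃ u, y u = a) ∧ a < c := by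
  simp [levelsBelow]

/-- The rank of `y u` among the values of `y` below `c`. All the vertices of value at least `c` are
put on the last level. -/
def levelIndex (u : V) : Fin ((levelsBelow y c).card + 1) :=
  if h : y u ∈ levelsBelow y c then
    (((levelsBelow y c).orderIsoOfFin rfl).symm ⟨y u, h⟩).castSucc
  else Fin.last _

variable {y c} {u w : V}

lemma levelIndex_of_lt (h : y u < c) : levelIndex y c u =
    (((levelsBelow y c).orderIsoOfFin rfl).symm
      ⟨y u, (mem_levelsBelow y c).2 ⟨⟨u, rfl⟩, h⟩⟩).castSucc :=
  dif_pos _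

lemma levelIndex_eq_last : levelIndex y c u = Fin.last _ ↔ c ≤ y u := by
  refine ⟨fun h => le_of_not_gt fun hlt => ?_, fun h => dif_neg fun hmem =>
    ((mem_levelsBelow y c).1 hmem).2.not_ge h⟩
  exact (Fin.castSucc_lt_last _).ne ((levelIndex_of_lt hlt).symm.trans h)

lemma levelIndex_lt_levelIndex : levelIndex y c u < levelIndex y c w ↔ y u < y w ∧ y u < c := by
  rcases lt_or_ge (y u) c with hu | hu
  · rcases lt_or_ge (y w) c with hw | hw
    · simp only [levelIndex_of_lt hu, levelIndex_of_lt hw, Fin.castSucc_lt_castSucc_iff,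
        OrderIso.lt_iff_lt, Subtype.mk_lt_mk, hu, and_true]
    · simp only [levelIndex_of_lt hu, levelIndex_eq_last.2 hw, Fin.castSucc_lt_last, hu,
        hu.trans_le hw, and_self]
  · simp only [levelIndex_eq_last.2 hu, (Fin.le_last _).not_gt, hu.not_gt, and_false]

lemma levelIndex_surjective (hu : c ≤ y u) : Function.Surjective (levelIndex y c) := by
  intro i
  induction i using Fin.lastCases with
  | last => exact ⟨u, levelIndex_eq_last.2 hu⟩
  | cast i =>
    obtain ⟨⟨w, hw⟩, hlt⟩ :=
      (mem_levelsBelow y c).1 ((levelsBelow y c).orderIsoOfFin rfl i).2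
    refine ⟨w, (levelIndex_of_lt (hw.trans_lt hlt)).trans (congrArg Fin.castSucc ?_)⟩
    exact (OrderIso.symm_apply_eq _).2 (Subtype.ext hw)

end Levels

lemma exists_forall_le_of_lt {V α : Type*} [Finite V] [LinearOrder α] (y : V → α) {a m : α}
    (ham : a < m) : ∃ m' < m, a ≤ m' ∧ ∀ u, y u < m → y u ≤ m' := by
  obtain ⟨m', hm', hmax⟩ := Set.exists_max_image (insert a {b ∈ Set.range y | b < m}) id
    (((Set.finite_range y).subset (Set.sep_subset _ _)).insert a) ⟨a, Set.mem_insert _ _⟩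
  refine ⟨m', ?_, hmax a (Set.mem_insert _ _), fun u hu =>
    hmax (y u) (Set.mem_insert_of_mem _ ⟨⟨u, rfl⟩, hu⟩)⟩
  rcases hm' with rfl | hm'
  · exact ham
  · exact hm'.2

section Lists

variable {α : Type*}

lemma exists_nodup_isChain_of_reflTransGen {r : α → α → Prop} {a b : α}
    (h : Relation.ReflTransGen r a b) : ∃ l : List α, l.IsChain r ∧ l.Nodup ∧
      l.head? = some a ∧ l.getLast? = some b := by
  induction h using Relation.ReflTransGen.head_induction_on with
  | refl => exact ⟨[b], by simp⟩
  | @head a c hac _ ih =>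
    obtain ⟨l, chain, nodup, head, last⟩ := ih
    by_cases ha : a ∈ l
    · obtain ⟨l₁, l₂, rfl⟩ := List.append_of_mem ha
      refine ⟨a :: l₂, chain.right_of_append, nodup.of_append_right, rfl, ?_⟩
      rw [← last, List.getLast?_append_of_ne_nil _ (List.cons_ne_nil _ _)]
    · obtain ⟨l, rfl⟩ := List.head?_eq_some_iff.1 head
      exact ⟨a :: c :: l, chain.cons_cons hac, nodup.cons ha, rfl, by
        rw [← last, List.getLast?_cons_cons]⟩

lemma exists_isChain_eq_of_nodup {l : List α} (h : l.Nodup) :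
    ∃ next : α → α, l.IsChain fun a b => next a = b := by
  classical
  refine ⟨fun a => (l[l.idxOf a + 1]?).getD a, List.isChain_iff_getElem.2 fun i hi => ?_⟩
  change (l[l.idxOf l[i] + 1]?).getD _ = _
  rw [h.idxOf_getElem, List.getElem?_eq_getElem hi, Option.getD_some]

end Lists

/-! ### From values to certificates -/

namespace TargetArena

variable {V : Type} [Fintype V] {A : TargetArena V} [Nonempty A.VN] {μ : A.NatureFamily}

omit [Nonempty A.VN] in
lemma exists_realVal_lt (hμ : μ.FullSupport) {u w : V} (hu : u ∈ A.VN) (hE : A.E u w)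
    (hlt : realVal μ u < realVal μ w) : ∃ w', A.E u w' ∧ realVal μ w' < realVal μ u := by
  by_contra! le_succ
  have := expect_lt_expect (u := ⟨u, hu⟩) hμ le_succ hE hlt
  rw [expect_const, ← realVal_nature] at this
  exact this.false

lemma isDriftPartition_levelIndex (hμ : μ.FullSupport) {c : ℝ} {v : V} (hv : c ≤ realVal μ v) :
    A.IsDriftPartition (levelIndex (realVal μ) c) := by
  refine isDriftPartition_iff.2 ⟨levelIndex_surjective hv, fun u w hE hlt => ?_⟩
  rw [levelIndex_lt_levelIndex] at hlt
  have hu : u ∉ A.VP := fun hu => (realVal_le_of_E μ hu hE).not_gt hlt.1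
  obtain ⟨w', hE', hw'⟩ := exists_realVal_lt hμ hu hE hlt.1
  exact ⟨hu, w', hE', levelIndex_lt_levelIndex.2 ⟨hw', hw'.trans hlt.2⟩⟩

-- Otherwise the value on `M` could be lowered to the next smaller value.
lemma exists_E_notMem_of_realVal_eq {M : Set V} {u : V} (hu : u ∈ M) {m : ℝ} (hm : 0 < m)
    (hM : ∀ u ∈ M, realVal μ u = m) (hT : ∀ u ∈ M, u ∉ A.T) :
    ∃ u ∈ M, ∃ w ∉ M, A.E u w ∧ m ≤ realVal μ w := by
  classical
  by_contra! lt_of_exit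
  obtain ⟨m', hm'm, hm'0, le_m'⟩ := exists_forall_le_of_lt (realVal μ) hm
  let x : V → ℝ := fun u => if u ∈ M then m' else realVal μ u
  have x_of_mem {u : V} (hu : u ∈ M) : x u = m' := if_pos hu
  have x_of_notMem {u : V} (hu : u ∉ M) : x u = realVal μ u := if_neg hu
  have x_le (u : V) : x u ≤ realVal μ u := by
    by_cases hu : u ∈ M
    · exact (x_of_mem hu).trans_le (hm'm.le.trans (hM u hu).ge)
    · exact (x_of_notMem hu).le
  have x_succ_le {u w : V} (hu : u ∈ M) (hE : A.E u w) : x w ≤ m' := by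
    by_cases hw : w ∈ M
    · exact (x_of_mem hw).le
    · exact (x_of_notMem hw).trans_le (le_m' w (lt_of_exit u hu w hw hE))
  have hle : realVal μ u ≤ x u := by
    refine realVal_le μ (fun w => ?_) (fun t ht => ?_) (fun p hp _ w hE => ?_) (fun u => ?_) u
    · by_cases hw : w ∈ M
      · exact hm'0.trans (x_of_mem hw).ge
      · exact (realVal_nonneg μ w).trans (x_of_notMem hw).ge
    · exact (realVal_target μ ht).ge.trans (x_of_notMem fun hM => hT t hM ht).ge
    · by_cases hp' : p ∈ M
      · exact (x_succ_le hp' hE).trans (x_of_mem hp').ge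
      · exact (x_le w).trans ((realVal_le_of_E μ hp hE).trans (x_of_notMem hp').ge)
    · by_cases hu : (u : V) ∈ M
      · exact (A.expect_le_of_forall_le μ u fun w => x_succ_le hu).trans (x_of_mem hu).ge
      · refine (A.expect_mono μ u fun w _ => x_le w).trans ?_
        exact ((realVal_nature μ u).symm.trans (x_of_notMem hu).symm).le
  rw [x_of_mem hu, hM u hu] at hle
  exact hm'm.not_ge hle

lemma exists_reflTransGen_target {v : V} (hv : 0 < realVal μ v) :
    ∃ t ∈ A.T, Relation.ReflTransGen (fun a b => A.E a b ∧ realVal μ v ≤ realVal μ b) v t := by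
  by_contra! no_target
  let R : Set V := {u | Relation.ReflTransGen (fun a b => A.E a b ∧ realVal μ v ≤ realVal μ b) v u}
  obtain ⟨u₀, hu₀, hmax⟩ := Set.exists_max_image R (realVal μ) (Set.toFinite _) ⟨v, .refl⟩
  have hvu₀ : realVal μ v ≤ realVal μ u₀ := hmax v .refl
  obtain ⟨u, hu, w, hw, hE, hle⟩ := exists_E_notMem_of_realVal_eq
    (M := {u | u ∈ R ∧ realVal μ u = realVal μ u₀}) ⟨hu₀, rfl⟩ (hv.trans_le hvu₀)
    (fun u hu => hu.2) fun u hu hT => no_target u hT hu.1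
  have hwR : w ∈ R := hu.1.tail ⟨hE, hvu₀.trans hle⟩
  exact hw ⟨hwR, (hmax w hwR).antisymm hle⟩

lemma exists_simplePathToTarget {v : V} (hv : 0 < realVal μ v) :
    ∃ π, A.IsSimplePathToTarget v π ∧ ∀ u ∈ π, realVal μ v ≤ realVal μ u := by
  obtain ⟨t, ht, hwalk⟩ := exists_reflTransGen_target hv
  obtain ⟨π, chain, nodup, head, last⟩ := exists_nodup_isChain_of_reflTransGen hwalk
  refine ⟨π, ⟨chain.imp fun _ _ h => h.1, nodup, head, t, ht, last⟩, ?_⟩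
  refine chain.induction _ _ (fun _ _ h _ => h.2) fun hne => ?_
  rw [List.head?_eq_some_head hne, Option.some_inj] at head
  rw [head]

theorem exists_isValid_of_not_neverWorse {W : Set V} (hW : W.Nonempty) {v : V}
    (h : ¬ A.NeverWorse v W) : ∃ c : Certificate V, c.IsValid A v W := by
  simp only [NeverWorse, not_forall, not_exists, not_and] at h
  obtain ⟨μ, hμ, not_le⟩ := h
  have lt_of_mem (w : V) (hw : w ∈ W) : realVal μ w < realVal μ v :=
    lt_of_not_ge fun hle => not_le w hw ((realVal_le_realVal μ).1 hle)
  obtain ⟨w₀, hw₀⟩ := hW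
  obtain ⟨π, hπ, le_of_mem⟩ := exists_simplePathToTarget
    ((realVal_nonneg μ w₀).trans_lt (lt_of_mem w₀ hw₀))
  refine ⟨⟨_, levelIndex (realVal μ) (realVal μ v), π⟩,
    isDriftPartition_levelIndex hμ le_rfl, hπ, fun u hu => ?_, fun t ht => ?_, fun w hw => ?_⟩
  · exact levelIndex_eq_last.2 (le_of_mem u hu)
  · exact levelIndex_eq_last.2 ((realVal_le_one μ v).trans_eq (realVal_target μ ht).symm)
  · exact mem_layersBelow.2 ((Fin.le_last _).lt_of_ne fun h =>
      (lt_of_mem w hw).not_ge (levelIndex_eq_last.1 h))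

end TargetArena

/-! ### From certificates to values -/

namespace TargetArena

variable {V : Type}

lemma exists_favoured_succ {A : TargetArena V} {k : ℕ} {part : V → Fin (k + 1)} {π : List V}
    (chain : π.IsChain A.E) (nodup : π.Nodup) (notMem : ∀ u ∈ π, u ∉ A.driftVertices part) :
    ∃ f : ∀ u : A.VN, A.succ u,
      (∀ u : A.VN, (u : V) ∈ A.driftVertices part → part (f u) < part u) ∧
      π.IsChain fun u w => A.E u w ∧ ∀ hu : u ∈ A.VN, (f ⟨u, hu⟩ : V) = w := by
  obtain ⟨next, hnext⟩ := exists_isChain_eq_of_nodup nodup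
  have exists_succ (u : A.VN) : ∃ w : A.succ u,
      ((u : V) ∈ A.driftVertices part → part w < part u) ∧
      ((u : V) ∈ π → A.E u (next u) → (w : V) = next u) := by
    by_cases hD : (u : V) ∈ A.driftVertices part
    · obtain ⟨-, -, w, hE, hlt⟩ := mem_driftVertices.1 hD
      exact ⟨⟨w, hE⟩, fun _ => hlt, fun hπ => absurd hD (notMem u hπ)⟩
    · by_cases hE : A.E u (next u)
      · exact ⟨⟨next u, hE⟩, fun h => absurd h hD, fun _ _ => rfl⟩
      · obtain ⟨w, hw⟩ := A.exists_succ u u.2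
        exact ⟨⟨w, hw⟩, fun h => absurd h hD, fun _ h => absurd h hE⟩
  choose f f_drift f_path using exists_succ
  refine ⟨f, f_drift, List.isChain_iff_getElem.2 fun i hi => ?_⟩
  have hE := List.isChain_iff_getElem.1 chain i hi
  have next_eq := List.isChain_iff_getElem.1 hnext i hi
  exact ⟨hE, fun hu => (f_path ⟨_, hu⟩ (List.getElem_mem _) (next_eq ▸ hE)).trans next_eq⟩

variable [Fintype V]

section Favouring

variable (A : TargetArena V) (f : ∀ u : A.VN, A.succ u) {a b : ℚ≥0} (hab : a + b = 1)

open scoped Classical in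
/-- The family that moves to the favoured successor `f u` with probability `b`, and to a uniformly
random successor otherwise. -/
def favouring (a b : ℚ≥0) (hab : a + b = 1) : A.NatureFamily := fun u =>
  { prob := fun w => a / Fintype.card (A.succ u) + if w = f u then b else 0
    sum_eq_one := by
      have card_ne_zero : (Fintype.card (A.succ u) : ℚ≥0) ≠ 0 :=
        Nat.cast_ne_zero.2 (Fintype.card_pos_iff.2 ⟨f u⟩).ne'
      rw [Finset.sum_add_distrib, Finset.sum_const, Finset.card_univ, nsmul_eq_mul,
        mul_div_cancel₀ _ card_ne_zero, Finset.sum_ite_eq', if_pos (Finset.mem_univ _), hab] }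

lemma favouring_fullSupport (ha : 0 < a) : (A.favouring f a b hab).FullSupport := by
  classical
  intro u w
  have card_pos : (0 : ℚ≥0) < Fintype.card (A.succ u) :=
    Nat.cast_pos.2 (Fintype.card_pos_iff.2 ⟨f u⟩)
  exact add_pos_of_pos_of_nonneg (div_pos ha card_pos) zero_le

open scoped Classical in
lemma expect_favouring (u : A.VN) (x : V → ℝ) :
    A.expect (A.favouring f a b hab) u x =
      a / Fintype.card (A.succ u) * ∑ w : A.succ u, x w + b * x (f u) := by
  simp only [expect, favouring, NNRat.cast_add, NNRat.cast_div, NNRat.cast_natCast, add_mul,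
    Finset.sum_add_distrib, Finset.mul_sum, apply_ite (NNRat.cast (K := ℝ)), NNRat.cast_zero,
    ite_mul, zero_mul, Finset.sum_ite_eq', Finset.mem_univ, if_true]

variable {A f} {u : A.VN} {x : V → ℝ}

lemma le_expect_favouring (hx : ∀ v, 0 ≤ x v) :
    b * x (f u) ≤ A.expect (A.favouring f a b hab) u x := by
  classical
  rw [expect_favouring]
  exact le_add_of_nonneg_left
    (mul_nonneg (by positivity) (Finset.sum_nonneg fun w _ => hx w))

lemma expect_favouring_le (hx : ∀ v, x v ≤ 1) :
    A.expect (A.favouring f a b hab) u x ≤ a + b * x (f u) := by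
  classical
  rw [expect_favouring]
  have card_ne_zero : (Fintype.card (A.succ u) : ℝ) ≠ 0 :=
    Nat.cast_ne_zero.2 (Fintype.card_pos_iff.2 ⟨f u⟩).ne'
  have sum_le : ∑ w : A.succ u, x w ≤ Fintype.card (A.succ u) :=
    (Finset.sum_le_card_nsmul Finset.univ (fun w : A.succ u => x w) 1 fun w _ => hx w).trans_eq
      (nsmul_one _)
  gcongr
  calc (a : ℝ) / Fintype.card (A.succ u) * ∑ w : A.succ u, x w
      ≤ a / Fintype.card (A.succ u) * Fintype.card (A.succ u) := by gcongr
    _ = a := div_mul_cancel₀ _ card_ne_zero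

end Favouring

section LayerBound

/-- An upper bound for the values in the `i`-th layer of a drift partition when Nature leaves the
favoured successors with probability `a`. -/
def layerBound {k : ℕ} (a : ℝ) (i : Fin (k + 1)) : ℝ := if i = Fin.last k then 1 else i * a

variable {k : ℕ} {a : ℝ} {i j : Fin (k + 1)}

lemma layerBound_last : layerBound a (Fin.last k) = 1 := if_pos rfl

lemma layerBound_of_lt (hi : i < Fin.last k) : layerBound a i = i * a := if_neg hi.ne

lemma layerBound_nonneg (ha : 0 ≤ a) : 0 ≤ layerBound a i := by
  unfold layerBound
  split_ifs <;> positivity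

lemma mul_le_mul_last (ha : 0 ≤ a) : (i : ℝ) * a ≤ k * a :=
  mul_le_mul_of_nonneg_right (Nat.cast_le.2 i.is_le) ha

lemma layerBound_le_one (ha : 0 ≤ a) (hka : k * a ≤ 1) : layerBound a i ≤ 1 := by
  unfold layerBound
  split_ifs
  · exact le_rfl
  · exact (mul_le_mul_last ha).trans hka

lemma layerBound_mono (ha : 0 ≤ a) (hka : k * a ≤ 1) (hij : i ≤ j) :
    layerBound a i ≤ layerBound a j := by
  rcases (Fin.le_last j).eq_or_lt with rfl | hj
  · exact (layerBound_le_one ha hka).trans_eq layerBound_last.symm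
  · rw [layerBound_of_lt hj, layerBound_of_lt (hij.trans_lt hj)]
    exact mul_le_mul_of_nonneg_right (Nat.cast_le.2 hij) ha

lemma add_layerBound_le (ha : 0 ≤ a) (hij : i < j) (hj : j < Fin.last k) :
    a + layerBound a i ≤ layerBound a j := by
  rw [layerBound_of_lt hj, layerBound_of_lt (hij.trans hj), add_comm, ← add_one_mul]
  exact mul_le_mul_of_nonneg_right (by exact_mod_cast hij) ha

end LayerBound

section Bounds

variable {A : TargetArena V} [Nonempty A.VN] {f : ∀ u : A.VN, A.succ u} {a b : ℚ≥0}
  {hab : a + b = 1}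

lemma realVal_favouring_le_layerBound {k : ℕ} {part : V → Fin (k + 1)}
    (hpart : A.IsDriftPartition part) (hT : ∀ t ∈ A.T, part t = Fin.last k)
    (hf : ∀ u : A.VN, (u : V) ∈ A.driftVertices part → part (f u) < part u)
    (hka : (k : ℝ) * a ≤ 1) (v : V) :
    realVal (A.favouring f a b hab) v ≤ layerBound (a : ℝ) (part v) := by
  have ha : (0 : ℝ) ≤ a := NNRat.cast_nonneg a
  have hb : (b : ℝ) ≤ 1 := by exact_mod_cast hab ▸ le_add_of_nonneg_left zero_le
  refine realVal_le (A.favouring f a b hab) (x := fun v => layerBound (a : ℝ) (part v))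
    (fun _ => layerBound_nonneg ha) (fun t ht => ?_) (fun p hp _ u hE => ?_) (fun u => ?_) v
  · rw [hT t ht, layerBound_last]
  · refine layerBound_mono ha hka (not_lt.1 fun hlt => ?_)
    exact (Set.eq_empty_iff_forall_notMem.1 (hpart.protagonist _ p ⟨rfl, hp⟩) u)
      ⟨hE, mem_layersAbove.2 hlt⟩
  · by_cases hD : (u : V) ∈ A.driftVertices part
    · have hlast := (mem_driftVertices.1 hD).1.2
      calc _ ≤ a + b * layerBound (a : ℝ) (part (f u)) :=
            expect_favouring_le hab fun _ => layerBound_le_one ha hka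
        _ ≤ a + layerBound (a : ℝ) (part (f u)) := by
            gcongr
            exact mul_le_of_le_one_left (layerBound_nonneg ha) hb
        _ ≤ layerBound (a : ℝ) (part u) := add_layerBound_le ha (hf u hD) hlast
    · refine A.expect_le_of_forall_le _ u fun w hE =>
        layerBound_mono ha hka (not_lt.1 fun hlt => ?_)
      exact hD (hpart.nature _ u ⟨rfl, u.2⟩ ⟨w, hE, mem_layersAbove.2 hlt⟩)

lemma realVal_sub_le_of_favoured {u w : V} (hE : A.E u w)
    (hf : ∀ hu : u ∈ A.VN, (f ⟨u, hu⟩ : V) = w) :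
    realVal (A.favouring f a b hab) w - a ≤ realVal (A.favouring f a b hab) u := by
  set μ := A.favouring f a b hab
  have ha : (0 : ℝ) ≤ a := NNRat.cast_nonneg a
  have habR : (a : ℝ) + b = 1 := by exact_mod_cast hab
  by_cases hu : u ∈ A.VP
  · exact (sub_le_self _ ha).trans (realVal_le_of_E μ hu hE)
  · calc realVal μ w - a ≤ realVal μ w - a * realVal μ w :=
          sub_le_sub_left (mul_le_of_le_one_right ha (realVal_le_one μ w)) _
      _ = b * realVal μ w := by rw [← sub_eq_of_eq_add' habR.symm]; ring
      _ = b * realVal μ (f ⟨u, hu⟩) := by rw [hf hu]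
      _ ≤ A.expect μ ⟨u, hu⟩ (realVal μ) := le_expect_favouring hab (realVal_nonneg μ)
      _ = realVal μ u := (realVal_nature μ ⟨u, hu⟩).symm

lemma one_sub_length_mul_le_realVal_favouring {π : List V} {v : V} (head : π.head? = some v)
    (chain : π.IsChain fun u w => A.E u w ∧ ∀ hu : u ∈ A.VN, (f ⟨u, hu⟩ : V) = w)
    (last : ∃ t ∈ A.T, π.getLast? = some t) :
    1 - (π.length : ℝ) * a ≤ realVal (A.favouring f a b hab) v := by
  induction π generalizing v with
  | nil => exact absurd head.symm (Option.some_ne_none v)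
  | cons u π ih =>
    obtain rfl : u = v := Option.some.inj head
    cases π with
    | nil =>
      obtain ⟨t, ht, hlast⟩ := last
      obtain rfl : u = t := Option.some.inj hlast
      rw [realVal_target _ ht]
      exact sub_le_self _ (by positivity)
    | cons w π =>
      obtain ⟨⟨hE, hf⟩, chain⟩ := List.isChain_cons_cons.1 chain
      have hw := ih rfl chain (List.getLast?_cons_cons (l := π) ▸ last)
      rw [List.length_cons, Nat.cast_succ]
      linarith [realVal_sub_le_of_favoured (hab := hab) hE hf]

end Bounds

theorem not_neverWorse_of_isValid {A : TargetArena V} [Nonempty A.VN] {W : Set V} {v : V}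
    {c : Certificate V} (hc : c.IsValid A v W) : ¬ A.NeverWorse v W := by
  obtain ⟨f, f_drift, f_path⟩ := exists_favoured_succ (part := c.part) hc.path_ok.chain
    hc.path_ok.simple fun u hu hD => (mem_driftVertices.1 hD).1.2.ne (hc.path_subset u hu)
  set N : ℕ := c.path.length + c.k with hN
  have hab : (1 / (N + 1) + N / (N + 1) : ℚ≥0) = 1 := by field_simp; ring
  set a : ℚ≥0 := 1 / (N + 1) with ha
  have ha0 : 0 < a := by positivity
  have hNa : (c.path.length : ℝ) * a + c.k * a < 1 := by
    rw [← add_mul, ← Nat.cast_add, ← hN, ha]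
    push_cast
    rw [mul_one_div, div_lt_one (by positivity)]
    exact lt_add_one _
  have hka : (c.k : ℝ) * a ≤ 1 := (le_add_of_nonneg_left (by positivity)).trans hNa.le
  intro hNW
  obtain ⟨w, hw, hle⟩ := hNW _ (A.favouring_fullSupport f hab ha0)
  have hlast : c.part w < Fin.last c.k := mem_layersBelow.1 (hc.W_subset hw)
  have lower := one_sub_length_mul_le_realVal_favouring (hab := hab) hc.path_ok.head f_path
    hc.path_ok.last
  have upper := realVal_favouring_le_layerBound (hab := hab) hc.drift
    (fun t ht => hc.target_subset ht) f_drift hka w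
  rw [layerBound_of_lt hlast] at upper
  linarith [(realVal_le_realVal _).2 hle, mul_le_mul_last (i := c.part w) (NNRat.cast_nonneg a)]

end TargetArena

/-! ### Programs for stack machines -/

section StackMachines

open Turing (TM2.Stmt TM2.Cfg TM2.step TM2.stepAux)

/-- The stack machine `m` reaches the configuration `c'` from `c` within `t` steps. -/
def RunsTo {K : Type} [DecidableEq K] {Γ : K → Type} {Λ σ : Type} (m : Λ → TM2.Stmt Γ Λ σ)
    (c c' : TM2.Cfg Γ Λ σ) (t : ℕ) : Prop :=
  ∃ n ≤ t, (flip bind (TM2.step m))^[n] (some c) = some c'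

namespace RunsTo

variable {K : Type} [DecidableEq K] {Γ : K → Type} {Λ σ : Type}
  {m : Λ → TM2.Stmt Γ Λ σ} {c c' c'' : TM2.Cfg Γ Λ σ} {t t' : ℕ}

lemma mono (h : RunsTo m c c' t) (ht : t ≤ t') : RunsTo m c c' t' := by
  obtain ⟨n, hn, h⟩ := h
  exact ⟨n, hn.trans ht, h⟩

lemma trans (h : RunsTo m c c' t) (h' : RunsTo m c' c'' t') : RunsTo m c c'' (t + t') := by
  obtain ⟨n, hn, h⟩ := h
  obtain ⟨n', hn', h'⟩ := h'
  refine ⟨n' + n, by lia, ?_⟩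
  rw [Function.iterate_add_apply, h, h']

lemma of_stepAux {l : Λ} {s : TM2.Stmt Γ Λ σ} {v : σ} {S : ∀ k, List (Γ k)} (hs : m l = s)
    (h : TM2.stepAux s v S = c) : RunsTo m ⟨some l, v, S⟩ c 1 := by
  subst hs h
  exact ⟨1, le_rfl, rfl⟩

end RunsTo

/-- Program fragments with one entry and one exit, to be linked into a machine: the statements are
given in terms of an embedding of the labels of the fragment and of the label to continue at. -/
structure StackProgram {K : Type} (Γ : K → Type) (σ : Type) where
  Label : Type
  [fintypeLabel : Fintype Label]
  start : Label
  code : ∀ {Λ : Type}, (Label → Λ) → Λ → Label → TM2.Stmt Γ Λ σ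

namespace StackProgram

attribute [instance] fintypeLabel

/-- A statement that ends with a jump either to its first argument, which repeats a loop, or to its
second argument, which leaves the loop. -/
abbrev LoopBody {K : Type} (Γ : K → Type) (σ : Type) : Type 1 :=
  ∀ Λ : Type, Λ → Λ → TM2.Stmt Γ Λ σ

variable {K : Type} [DecidableEq K] {Γ : K → Type} {τ : Type}
  {p q : StackProgram Γ (Bool × τ)} {body : LoopBody Γ (Bool × τ)} {b b₁ b₂ b' : Bool}
  {S S₁ S₂ S' : ∀ k, List (Γ k)} {t t' : ℕ}

/-- Started with the stacks `S` and the Boolean register `b`, the program ends within `t` steps with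
the stacks `S'` and the Boolean register `b'`. -/
def Spec (p : StackProgram Γ (Bool × τ)) (b : Bool) (S : ∀ k, List (Γ k)) (b' : Bool)
    (S' : ∀ k, List (Γ k)) (t : ℕ) : Prop :=
  ∀ r : τ, ∃ r' : τ, ∀ (Λ : Type) (emb : p.Label → Λ) (exit : Λ)
    (m : Λ → TM2.Stmt Γ Λ (Bool × τ)), (∀ l, m (emb l) = p.code emb exit l) →
    RunsTo m ⟨some (emb p.start), (b, r), S⟩ ⟨some exit, (b', r'), S'⟩ t

/-- The loop body repeats the loop. -/
def LoopBody.Repeats (body : LoopBody Γ (Bool × τ)) (b : Bool) (S : ∀ k, List (Γ k)) (b' : Bool)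
    (S' : ∀ k, List (Γ k)) : Prop :=
  ∀ r, ∃ r', ∀ (Λ : Type) (again exit : Λ),
    TM2.stepAux (body Λ again exit) (b, r) S = ⟨some again, (b', r'), S'⟩

/-- The loop body leaves the loop. -/
def LoopBody.Leaves (body : LoopBody Γ (Bool × τ)) (b : Bool) (S : ∀ k, List (Γ k)) (b' : Bool)
    (S' : ∀ k, List (Γ k)) : Prop :=
  ∀ r, ∃ r', ∀ (Λ : Type) (again exit : Λ),
    TM2.stepAux (body Λ again exit) (b, r) S = ⟨some exit, (b', r'), S'⟩

lemma Spec.mono (h : p.Spec b S b' S' t) (ht : t ≤ t') : p.Spec b S b' S' t' := fun r =>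
  let ⟨r', h⟩ := h r
  ⟨r', fun Λ emb exit m hm => (h Λ emb exit m hm).mono ht⟩

/-- The program that repeats a single statement. -/
def loop (body : LoopBody Γ (Bool × τ)) : StackProgram Γ (Bool × τ) where
  Label := Unit
  start := ()
  code emb exit _ := body _ (emb ()) exit

lemma Spec.loop_of_repeats (h₁ : body.Repeats b S b₁ S₁) (h : (loop body).Spec b₁ S₁ b' S' t) :
    (loop body).Spec b S b' S' (t + 1) := by
  intro r
  obtain ⟨r₁, h₁⟩ := h₁ r
  obtain ⟨r', h⟩ := h r₁
  refine ⟨r', fun Λ emb exit m hm => ?_⟩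
  rw [add_comm]
  exact (RunsTo.of_stepAux (hm ()) (h₁ _ _ _)).trans (h Λ emb exit m hm)

lemma Spec.loop_of_leaves (h : body.Leaves b S b' S') : (loop body).Spec b S b' S' 1 := by
  intro r
  obtain ⟨r', h⟩ := h r
  exact ⟨r', fun _ _ _ _ hm => RunsTo.of_stepAux (hm ()) (h _ _ _)⟩

/-- Sequential composition. -/
def seq (p q : StackProgram Γ (Bool × τ)) : StackProgram Γ (Bool × τ) where
  Label := p.Label ⊕ q.Label
  start := .inl p.start
  code emb exit l :=
    match l with
    | .inl l => p.code (fun l => emb (.inl l)) (emb (.inr q.start)) l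
    | .inr l => q.code (fun l => emb (.inr l)) exit l

lemma Spec.seq (h : p.Spec b S b₁ S₁ t) (h' : q.Spec b₁ S₁ b' S' t') :
    (p.seq q).Spec b S b' S' (t + t') := by
  intro r
  obtain ⟨r₁, h⟩ := h r
  obtain ⟨r', h'⟩ := h' r₁
  exact ⟨r', fun Λ emb exit m hm => (h Λ (fun l => emb (.inl l)) _ m fun l => hm (.inl l)).trans
    (h' Λ (fun l => emb (.inr l)) exit m fun l => hm (.inr l))⟩

/-- Execution under the condition that the Boolean register is true. -/
def whenTrue (p : StackProgram Γ (Bool × τ)) : StackProgram Γ (Bool × τ) where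
  Label := Option p.Label
  start := none
  code emb exit l :=
    match l with
    | none => .branch Prod.fst (.goto fun _ => emb (some p.start)) (.goto fun _ => exit)
    | some l => p.code (fun l => emb (some l)) exit l

lemma Spec.whenTrue_true (h : p.Spec true S b' S' t) : p.whenTrue.Spec true S b' S' (1 + t) := by
  intro r
  obtain ⟨r', h⟩ := h r
  exact ⟨r', fun Λ emb exit m hm =>
    (RunsTo.of_stepAux (hm none) rfl).trans
      (h Λ (fun l => emb (some l)) exit m fun l => hm (some l))⟩

lemma Spec.whenTrue_false : p.whenTrue.Spec false S false S 1 := fun r =>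
  ⟨r, fun _ _ _ _ hm => RunsTo.of_stepAux (hm none) rfl⟩

/-- The program that repeats `p` until `body` leaves the loop. -/
def rep (p : StackProgram Γ (Bool × τ)) (body : LoopBody Γ (Bool × τ)) :
    StackProgram Γ (Bool × τ) where
  Label := Option p.Label
  start := some p.start
  code emb exit l :=
    match l with
    | none => body _ (emb (some p.start)) exit
    | some l => p.code (fun l => emb (some l)) (emb none) l

lemma Spec.rep_of_repeats (h : p.Spec b S b₁ S₁ t) (h₁ : body.Repeats b₁ S₁ b₂ S₂)
    (h' : (rep p body).Spec b₂ S₂ b' S' t') : (rep p body).Spec b S b' S' (t + 1 + t') := by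
  intro r
  obtain ⟨r₁, h⟩ := h r
  obtain ⟨r₂, h₁⟩ := h₁ r₁
  obtain ⟨r', h'⟩ := h' r₂
  exact ⟨r', fun Λ emb exit m hm =>
    ((h Λ (fun l => emb (some l)) (emb none) m fun l => hm (some l)).trans
      (RunsTo.of_stepAux (hm none) (h₁ _ _ _))).trans (h' Λ emb exit m hm)⟩

lemma Spec.rep_of_leaves (h : p.Spec b S b₁ S₁ t) (h₁ : body.Leaves b₁ S₁ b' S') :
    (rep p body).Spec b S b' S' (t + 1) := by
  intro r
  obtain ⟨r₁, h⟩ := h r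
  obtain ⟨r₂, h₁⟩ := h₁ r₁
  exact ⟨r₂, fun Λ emb exit m hm =>
    (h Λ (fun l => emb (some l)) (emb none) m fun l => hm (some l)).trans
      (RunsTo.of_stepAux (hm none) (h₁ _ _ _))⟩

end StackProgram

end StackMachines

section EvaluationPrograms

open Turing (TM2.Stmt TM2.stepAux)

/-- The stacks of the machines that evaluate formulas over words: the part of the input that is
still to be read, the part read already (reversed), the values of `M` variables in unary, a store
for the variable in use, a counter, and the output. -/
inductive EvalStack (M : ℕ) : Type
  | inp | rev | var (i : Fin M) | sav | cnt | out
  deriving DecidableEq, Fintype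

namespace EvalStack

variable {M : ℕ} {Γ : Type}

/-- The alphabets of the stacks. -/
def Alphabet (Γ : Type) : EvalStack M → Type
  | inp => Γ
  | rev => Γ
  | var _ => Unit
  | sav => Unit
  | cnt => Unit
  | out => Bool

/-- The contents of the stacks before the output is written. -/
def mem (l r : List Γ) (E : Fin M → ℕ) (s c : ℕ) : ∀ k : EvalStack M, List (Alphabet Γ k)
  | inp => l
  | rev => r
  | var i => List.replicate (E i) ()
  | sav => List.replicate s ()
  | cnt => List.replicate c ()
  | out => []

variable (l r l' r' : List Γ) (E E' : Fin M → ℕ) (s c s' c' : ℕ)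

lemma update_inp : Function.update (mem l r E s c) inp l' = mem l' r E s c := by
  funext k; cases k <;> rfl

lemma update_rev : Function.update (mem l r E s c) rev r' = mem l r' E s c := by
  funext k; cases k <;> rfl

lemma update_sav :
    Function.update (mem l r E s c) sav (List.replicate s' ()) = mem l r E s' c := by
  funext k; cases k <;> rfl

lemma update_cnt :
    Function.update (mem l r E s c) cnt (List.replicate c' ()) = mem l r E s c' := by
  funext k; cases k <;> rfl

lemma update_var (i : Fin M) (n : ℕ) :
    Function.update (mem l r E s c) (var i) (List.replicate n ()) =
      mem l r (Function.update E i n) s c := by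
  funext k
  rcases eq_or_ne k (var i) with rfl | hk
  · rw [Function.update_self]
    exact congrArg (List.replicate · ()) (Function.update_self i n E).symm
  · rw [Function.update_of_ne hk]
    cases k with
    | var j =>
      exact congrArg (List.replicate · ()) (Function.update_of_ne (hk <| congrArg var ·) n E).symm
    | _ => rfl

lemma pop_inp : Function.update (mem l r E s c) inp (mem l' r' E' s' c' inp).tail =
    mem l'.tail r E s c := update_inp ..

lemma pop_rev : Function.update (mem l r E s c) rev (mem l' r' E' s' c' rev).tail =
    mem l r'.tail E s c := update_rev ..

lemma pop_var (i : Fin M) :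
    Function.update (mem l r E s c) (var i) (mem l' r' E' s' c' (var i)).tail =
      mem l r (Function.update E i (E' i - 1)) s c :=
  (congrArg _ List.tail_replicate).trans (update_var ..)

lemma pop_sav : Function.update (mem l r E s c) sav (mem l' r' E' s' c' sav).tail =
    mem l r E (s' - 1) c :=
  (congrArg _ List.tail_replicate).trans (update_sav ..)

lemma pop_cnt : Function.update (mem l r E s c) cnt (mem l' r' E' s' c' cnt).tail =
    mem l r E s (c' - 1) :=
  (congrArg _ List.tail_replicate).trans (update_cnt ..)

lemma push_inp (a : Γ) : Function.update (mem l r E s c) inp (a :: mem l' r' E' s' c' inp) =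
    mem (a :: l') r E s c := update_inp ..

lemma push_rev (a : Γ) : Function.update (mem l r E s c) rev (a :: mem l' r' E' s' c' rev) =
    mem l (a :: r') E s c := update_rev ..

lemma push_var (i : Fin M) :
    Function.update (mem l r E s c) (var i) (() :: mem l' r' E' s' c' (var i)) =
      mem l r (Function.update E i (E' i + 1)) s c :=
  update_var l r E s c i (E' i + 1)

lemma push_sav : Function.update (mem l r E s c) sav (() :: mem l' r' E' s' c' sav) =
    mem l r E (s' + 1) c :=
  update_sav l r E s c (s' + 1)

lemma push_cnt : Function.update (mem l r E s c) cnt (() :: mem l' r' E' s' c' cnt) =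
    mem l r E s (c' + 1) :=
  update_cnt l r E s c (c' + 1)

lemma isSome_head_replicate (n : ℕ) : (List.replicate n ()).head?.isSome = decide (0 < n) := by
  cases n with
  | zero => rfl
  | succ n => exact (decide_eq_true (Nat.succ_pos _)).symm

lemma head_inp : (mem l r E s c inp).head? = l.head? := rfl

lemma head_rev : (mem l r E s c rev).head? = r.head? := rfl

lemma isSome_head_var (i : Fin M) : (mem l r E s c (var i)).head?.isSome = decide (0 < E i) :=
  isSome_head_replicate _

lemma isSome_head_sav : (mem l r E s c sav).head?.isSome = decide (0 < s) :=
  isSome_head_replicate _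

lemma isSome_head_cnt : (mem l r E s c cnt).head?.isSome = decide (0 < c) :=
  isSome_head_replicate _

end EvalStack

open EvalStack

attribute [local simp] TM2.stepAux pop_inp pop_rev pop_var pop_sav pop_cnt push_inp push_rev
  push_var push_sav push_cnt head_inp head_rev isSome_head_var isSome_head_sav isSome_head_cnt

/-- Programs on the stacks of the formula evaluation: the registers hold a Boolean, the last letter
popped, and whether the last pop of a unary stack was successful. -/
abbrev EvalProgram (Γ : Type) (M : ℕ) : Type 1 :=
  StackProgram (Alphabet Γ (M := M)) (Bool × Option Γ × Bool)

namespace EvalProgram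

open StackProgram (Spec.mono Spec.loop_of_repeats Spec.loop_of_leaves)

variable {Γ : Type} {M : ℕ} (x : Fin M) (b : Bool) (l r : List Γ) (E : Fin M → ℕ) (s c : ℕ)

/-- Pop from a unary stack. -/
abbrev popUnary {Λ : Type} (k : EvalStack M)
    (q : TM2.Stmt (Alphabet Γ (M := M)) Λ (Bool × Option Γ × Bool)) :
    TM2.Stmt (Alphabet Γ (M := M)) Λ (Bool × Option Γ × Bool) :=
  .pop k (fun v o => (v.1, v.2.1, o.isSome)) q

/-- Load a function of the Boolean register. -/
def assign (f : Bool → Bool) : EvalProgram Γ M :=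
  .loop fun _ _ exit => .load (fun v => (f v.1, v.2)) (.goto fun _ => exit)

lemma assign_spec (f : Bool → Bool) (S : ∀ k : EvalStack M, List (Alphabet Γ k)) :
    (assign f).Spec b S (f b) S 1 :=
  Spec.loop_of_leaves fun r => ⟨r, fun _ _ _ => rfl⟩

/-- Move the unary number on the stack `sav` to a variable. -/
def restore : EvalProgram Γ M :=
  .loop fun _ again exit => popUnary sav
    (.branch (·.2.2) (.push (var x) (fun _ => ()) (.goto fun _ => again)) (.goto fun _ => exit))

lemma restore_spec : (restore x).Spec b (mem l r E s c) b
    (mem l r (Function.update E x (E x + s)) 0 c) (s + 1) := by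
  induction s generalizing E with
  | zero => exact Spec.loop_of_leaves fun ρ => ⟨(ρ.1, false), fun _ _ _ => by simp⟩
  | succ s ih =>
    have h := ih (Function.update E x (E x + 1))
    rw [Function.update_self, Function.update_idem, add_assoc, add_comm 1 s] at h
    exact Spec.loop_of_repeats (fun ρ => ⟨(ρ.1, true), fun _ _ _ => by simp⟩) h

/-- Subtract a variable from the counter; the Boolean register becomes false if this is not
possible. The variable is moved to the stack `sav`. -/
def subtract : EvalProgram Γ M :=
  .loop fun _ again exit => popUnary (var x)
    (.branch (·.2.2)
      (.push sav (fun _ => ()) (popUnary cnt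
        (.branch (·.2.2) (.goto fun _ => again)
          (.load (fun v => (false, v.2)) (.goto fun _ => again)))))
      (.goto fun _ => exit))

lemma subtract_spec : (subtract x).Spec b (mem l r E s c) (b && decide (E x ≤ c))
    (mem l r (Function.update E x 0) (s + E x) (c - E x)) (E x + 1) := by
  induction hn : E x generalizing E b s c with
  | zero => exact Spec.mono (Spec.loop_of_leaves fun ρ =>
      ⟨(ρ.1, false), fun _ _ _ => by simp [hn]⟩) (Nat.le_add_left _ _)
  | succ n ih =>
    have h := ih (b && decide (0 < c)) (Function.update E x n) (s + 1) (c - 1) (by simp)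
    have h_register : (b && decide (0 < c) && decide (n ≤ c - 1)) = (b && decide (n + 1 ≤ c)) := by
      rw [Bool.and_assoc, ← Bool.decide_and,
        decide_eq_decide.2 (show 0 < c ∧ n ≤ c - 1 ↔ n + 1 ≤ c by lia)]
    rw [Function.update_idem, h_register, show s + 1 + n = s + (n + 1) by lia,
      show c - 1 - n = c - (n + 1) by lia] at h
    refine Spec.loop_of_repeats (fun ρ => ⟨(ρ.1, decide (0 < c)), fun _ _ _ => ?_⟩) h
    rcases c with _ | c <;> simp [hn]

/-- Empty the counter; the Boolean register becomes false unless the counter was empty. -/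
def testZero : EvalProgram Γ M :=
  .loop fun _ again exit => popUnary cnt
    (.branch (·.2.2) (.load (fun v => (false, v.2)) (.goto fun _ => again)) (.goto fun _ => exit))

lemma testZero_spec :
    testZero.Spec b (mem l r E s c) (b && decide (c = 0)) (mem l r E s 0) (c + 1) := by
  induction c generalizing b with
  | zero => exact Spec.loop_of_leaves fun ρ => ⟨(ρ.1, false), fun _ _ _ => by simp⟩
  | succ c ih =>
    have h := ih false
    rw [Bool.false_and] at h
    rw [decide_eq_false c.succ_ne_zero, Bool.and_false]
    exact Spec.loop_of_repeats (fun ρ => ⟨(ρ.1, true), fun _ _ _ => by simp⟩) h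

/-- Empty a variable. -/
def clear : EvalProgram Γ M :=
  .loop fun _ again exit => popUnary (var x)
    (.branch (·.2.2) (.goto fun _ => again) (.goto fun _ => exit))

lemma clear_spec : (clear x).Spec b (mem l r E s c) b (mem l r (Function.update E x 0) s c)
    (E x + 1) := by
  induction hn : E x generalizing E with
  | zero => exact Spec.mono (Spec.loop_of_leaves fun ρ =>
      ⟨(ρ.1, false), fun _ _ _ => by simp [hn]⟩) (Nat.le_add_left _ _)
  | succ n ih =>
    have h := ih (Function.update E x n) (by simp)
    rw [Function.update_idem] at h
    exact Spec.loop_of_repeats (fun ρ => ⟨(ρ.1, true), fun _ _ _ => by simp [hn]⟩) h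

variable [Inhabited Γ]

/-- Move the stack `rev` back to the input. -/
def rewind : EvalProgram Γ M :=
  .loop fun _ again exit => .pop rev (fun v o => (v.1, o, v.2.2))
    (.branch (·.2.1.isSome) (.push inp (fun v => v.2.1.getD default) (.goto fun _ => again))
      (.goto fun _ => exit))

lemma rewind_spec :
    rewind.Spec b (mem l r E s c) b (mem (r.reverse ++ l) [] E s c) (r.length + 1) := by
  induction r generalizing l with
  | nil => exact Spec.loop_of_leaves fun ρ => ⟨(none, ρ.2), fun _ _ _ => by simp⟩
  | cons a r ih =>
    rw [List.reverse_cons, List.append_assoc]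
    exact Spec.loop_of_repeats (fun ρ => ⟨(some a, ρ.2), fun _ _ _ => by simp⟩) (ih (a :: l))

/-- Read a prefix of the input whose length is given by a variable, and count letters. -/
def countPrefix (p : Γ → Bool) : EvalProgram Γ M :=
  .loop fun _ again exit => popUnary (var x)
    (.branch (·.2.2)
      (.push sav (fun _ => ()) (.pop inp (fun v o => (v.1, o, v.2.2))
        (.branch (·.2.1.isSome)
          (.push rev (fun v => v.2.1.getD default)
            (.branch (·.2.1.any p) (.push cnt (fun _ => ()) (.goto fun _ => again))
              (.goto fun _ => again)))
          (.goto fun _ => again))))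
      (.goto fun _ => exit))

lemma countPrefix_spec (p : Γ → Bool) : (countPrefix x p).Spec b (mem l r E s c) b
    (mem (l.drop (E x)) ((l.take (E x)).reverse ++ r) (Function.update E x 0) (s + E x)
      (c + (l.take (E x)).countP p)) (E x + 1) := by
  induction hn : E x generalizing E l r s c with
  | zero => exact Spec.mono (Spec.loop_of_leaves fun ρ =>
      ⟨(ρ.1, false), fun _ _ _ => by simp [hn]⟩) (Nat.le_add_left _ _)
  | succ n ih =>
    cases l with
    | nil =>
      have h := ih [] r (Function.update E x n) (s + 1) c (by simp)
      rw [Function.update_idem, add_assoc s 1 n, add_comm 1 n, List.take_nil, List.drop_nil] at h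
      rw [List.take_nil, List.drop_nil]
      exact Spec.loop_of_repeats (fun ρ => ⟨(none, true), fun _ _ _ => by simp [hn]⟩) h
    | cons a l =>
      have h := ih l (a :: r) (Function.update E x n) (s + 1) (c + if p a then 1 else 0) (by simp)
      rw [Function.update_idem, add_assoc s 1 n, add_comm 1 n, add_assoc c, add_comm (ite _ _ _),
        ← List.countP_cons, ← List.take_succ_cons] at h
      rw [List.take_succ_cons, List.reverse_cons, List.append_assoc, ← List.take_succ_cons]
      refine Spec.loop_of_repeats (fun ρ => ⟨(some a, true), fun _ _ _ => ?_⟩) h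
      by_cases ha : p a <;> simp [hn, ha]

/-- Set a variable to the length of the input, which is moved to the stack `rev`. -/
def measure : EvalProgram Γ M :=
  .loop fun _ again exit => .pop inp (fun v o => (v.1, o, v.2.2))
    (.branch (·.2.1.isSome)
      (.push rev (fun v => v.2.1.getD default) (.push (var x) (fun _ => ()) (.goto fun _ => again)))
      (.goto fun _ => exit))

lemma measure_spec : (measure x).Spec b (mem l r E s c) b
    (mem [] (l.reverse ++ r) (Function.update E x (E x + l.length)) s c) (l.length + 1) := by
  induction l generalizing r E with
  | nil => exact Spec.loop_of_leaves fun ρ => ⟨(none, ρ.2), fun _ _ _ => by simp⟩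
  | cons a l ih =>
    have h := ih (a :: r) (Function.update E x (E x + 1))
    rw [Function.update_self, Function.update_idem, add_assoc, add_comm 1] at h
    rw [List.reverse_cons, List.append_assoc]
    exact Spec.loop_of_repeats (fun ρ => ⟨(some a, ρ.2), fun _ _ _ => by simp⟩) h

/-- Set the Boolean register to the truth value of the statement that the prefix of length `x`
contains `y + z` letters of the kind `p`. -/
def testCount (p : Γ → Bool) (x y z : Fin M) : EvalProgram Γ M :=
  ((((((((countPrefix x p).seq (restore x)).seq rewind).seq (assign fun _ => true)).seq
    (subtract y)).seq (restore y)).seq (subtract z)).seq (restore z)).seq testZero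

lemma testCount_spec (p : Γ → Bool) (w : List Γ) (y z : Fin M) (hE : ∀ i, E i ≤ w.length) :
    (testCount p x y z).Spec b (mem w [] E 0 0)
      (decide ((w.take (E x)).countP p = E y + E z)) (mem w [] E 0 0) (8 * (w.length + 1) + 1) := by
  set c := (w.take (E x)).countP p with hc
  have hcw : c ≤ w.length := List.countP_le_length.trans (List.length_take_le' ..)
  have h_register : (decide (E y ≤ c) && decide (E z ≤ c - E y) && decide (c - E y - E z = 0)) =
      decide (c = E y + E z) := by
    rw [← Bool.decide_and, ← Bool.decide_and]
    exact decide_eq_decide.2 (by lia)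
  have h := ((((((((countPrefix_spec x b w [] E 0 0 p).seq (restore_spec x _ _ _ _ _ _)).seq
    (rewind_spec _ _ _ _ _ _)).seq (assign_spec _ (fun _ => true) _)).seq
    (subtract_spec y _ _ _ _ _ _)).seq (restore_spec y _ _ _ _ _ _)).seq
    (subtract_spec z _ _ _ _ _ _)).seq (restore_spec z _ _ _ _ _ _)).seq
    (testZero_spec _ _ _ _ _ _)
  simp only [Function.update_self, Function.update_idem, zero_add, Function.update_eq_self,
    List.append_nil, List.reverse_reverse, List.take_append_drop, Bool.true_and, ← hc,
    h_register] at h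
  refine h.mono ?_
  have hx := hE x
  have hy := hE y
  have hz := hE z
  simp only [List.length_reverse, List.length_take]
  lia

end EvalProgram

end EvaluationPrograms

/-! ### First-order formulas over words -/

/-- First-order formulas over words, with `d` free variables that range over the numbers up to the
length of the word. -/
inductive WordFormula (Γ : Type) : ℕ → Type
  | count {d : ℕ} (p : Γ → Bool) (x y z : Fin d) : WordFormula Γ d
  | not {d : ℕ} (φ : WordFormula Γ d) : WordFormula Γ d
  | and {d : ℕ} (φ ψ : WordFormula Γ d) : WordFormula Γ d
  | ex {d : ℕ} (φ : WordFormula Γ (d + 1)) : WordFormula Γ d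

namespace WordFormula

open Turing (TM2.Stmt TM2.Cfg TM2.stepAux)

variable {Γ : Type} {d M : ℕ}

/-- The semantics of formulas: the atom `count p x y z` says that the prefix of length `x` contains
`y + z` letters of the kind `p`, and a quantifier binds the last variable. -/
def Eval (w : List Γ) : ∀ {d : ℕ}, WordFormula Γ d → (Fin d → ℕ) → Prop
  | _, count p x y z, e => (w.take (e x)).countP p = e y + e z
  | _, not φ, e => ¬ φ.Eval w e
  | _, and φ ψ, e => φ.Eval w e ∧ ψ.Eval w e
  | _, ex φ, e => ∃ i ≤ w.length, φ.Eval w (Fin.snoc e i)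

/-- The number of variables, free or bound. -/
def width : ∀ {d : ℕ}, WordFormula Γ d → ℕ
  | d, count _ _ _ _ => d
  | _, not φ => φ.width
  | _, and φ ψ => max φ.width ψ.width
  | _, ex φ => φ.width

lemma le_width : ∀ {d : ℕ} (φ : WordFormula Γ d), d ≤ φ.width
  | _, count _ _ _ _ => le_rfl
  | _, not φ => φ.le_width
  | _, and φ _ => φ.le_width.trans (le_max_left _ _)
  | _, ex φ => (Nat.le_succ _).trans φ.le_width

end WordFormula

section Padding

variable {d M n : ℕ} {e : Fin d → ℕ}

/-- The family of `M` numbers that starts with the given one and goes on with zeros. -/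
def padZeros (M : ℕ) (e : Fin d → ℕ) (i : Fin M) : ℕ :=
  if h : i < d then e ⟨i, h⟩ else 0

lemma padZeros_castLE (h : d ≤ M) (i : Fin d) : padZeros M e (Fin.castLE h i) = e i :=
  dif_pos i.2

lemma padZeros_of_le {i : Fin M} (h : d ≤ i) : padZeros M e i = 0 :=
  dif_neg h.not_gt

lemma padZeros_le (he : ∀ i, e i ≤ n) (i : Fin M) : padZeros M e i ≤ n := by
  unfold padZeros
  split
  exacts [he _, n.zero_le]

lemma update_padZeros (h : d < M) (j : ℕ) :
    Function.update (padZeros M e) ⟨d, h⟩ j = padZeros M (Fin.snoc e j : Fin (d + 1) → ℕ) := by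
  funext i
  rcases lt_trichotomy (i : ℕ) d with hi | hi | hi
  · rw [Function.update_of_ne (Fin.ne_of_lt hi)]
    simp [padZeros, hi, hi.le, Fin.snoc, Order.lt_add_one_iff]
  · obtain rfl : i = ⟨d, h⟩ := Fin.ext hi
    simp [padZeros, Fin.snoc]
  · rw [Function.update_of_ne (Fin.ne_of_gt hi), padZeros_of_le hi.le, padZeros_of_le hi]

end Padding

namespace EvalProgram

open EvalStack
open Turing (TM2.stepAux)

variable {Γ : Type} {M : ℕ} {x : Fin M} {w : List Γ} {E : Fin M → ℕ} {P : ℕ → Prop}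
  [DecidablePred P] {p : EvalProgram Γ M} {t : ℕ}

/-- Leave a search if the Boolean register is true, and otherwise go on with the predecessor of the
variable, if there is one. -/
def searchBody (x : Fin M) : StackProgram.LoopBody (Alphabet Γ (M := M)) (Bool × Option Γ × Bool) :=
  fun _ again exit => .branch Prod.fst (.goto fun _ => exit)
    (popUnary (var x) (.branch (·.2.2) (.goto fun _ => again) (.goto fun _ => exit)))

lemma searchBody_repeats (i : ℕ) :
    (searchBody x).Repeats false (mem w [] (Function.update E x (i + 1)) 0 0) false
      (mem w [] (Function.update E x i) 0 0) :=
  fun ρ => ⟨(ρ.1, true), fun _ _ _ => by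
    simp [searchBody, TM2.stepAux, isSome_head_var, pop_var]⟩

lemma searchBody_leaves_of_true (S : ∀ k : EvalStack M, List (Alphabet Γ k)) :
    (searchBody x).Leaves true S true S :=
  fun ρ => ⟨ρ, fun _ _ _ => rfl⟩

lemma searchBody_leaves_of_zero (b : Bool) :
    (searchBody x).Leaves b (mem w [] (Function.update E x 0) 0 0) b
      (mem w [] (Function.update E x 0) 0 0) := by
  cases b with
  | false => exact fun ρ => ⟨(ρ.1, false), fun _ _ _ => by
      simp [searchBody, TM2.stepAux, isSome_head_var, pop_var]⟩
  | true => exact searchBody_leaves_of_true _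

lemma rep_searchBody_spec
    (hp : ∀ i ≤ w.length, ∀ b, p.Spec b (mem w [] (Function.update E x i) 0 0) (decide (P i))
      (mem w [] (Function.update E x i) 0 0) t) {i : ℕ} (hi : i ≤ w.length) (b : Bool) :
    ∃ m ≤ w.length, (p.rep (searchBody x)).Spec b (mem w [] (Function.update E x i) 0 0)
      (decide (∃ j ≤ i, P j)) (mem w [] (Function.update E x m) 0 0) ((i + 1) * (t + 1)) := by
  induction i generalizing b with
  | zero =>
    refine ⟨0, hi, ?_⟩
    rw [zero_add, one_mul, decide_eq_decide.2 (show (∃ j ≤ 0, P j) ↔ P 0 by simp)]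
    exact (hp 0 hi b).rep_of_leaves (searchBody_leaves_of_zero _)
  | succ i ih =>
    have h := hp (i + 1) hi b
    by_cases hP : P (i + 1)
    · rw [decide_eq_true hP] at h
      rw [decide_eq_true ⟨i + 1, le_rfl, hP⟩]
      exact ⟨i + 1, hi, (h.rep_of_leaves (searchBody_leaves_of_true _)).mono
        (Nat.le_mul_of_pos_left _ (Nat.succ_pos _))⟩
    · rw [decide_eq_false hP] at h
      have h_exists : (∃ j ≤ i + 1, P j) ↔ ∃ j ≤ i, P j := by
        simp [Nat.le_succ_iff, or_and_right, exists_or, hP]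
      obtain ⟨m, hm, h'⟩ := ih (Nat.le_of_succ_le hi) false
      rw [← decide_eq_decide.2 h_exists] at h'
      refine ⟨m, hm, (h.rep_of_repeats (searchBody_repeats i) h').mono (le_of_eq ?_)⟩
      ring

variable [Inhabited Γ]

/-- Execute the program `p` for all values of the variable `x` from the length of the input
downwards, until the Boolean register is true. -/
def search (p : EvalProgram Γ M) (x : Fin M) : EvalProgram Γ M :=
  (((measure x).seq rewind).seq (p.rep (searchBody x))).seq (clear x)

lemma search_spec (hx : E x = 0)
    (hp : ∀ i ≤ w.length, ∀ b, p.Spec b (mem w [] (Function.update E x i) 0 0) (decide (P i))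
      (mem w [] (Function.update E x i) 0 0) t) (b : Bool) :
    (search p x).Spec b (mem w [] E 0 0) (decide (∃ i ≤ w.length, P i)) (mem w [] E 0 0)
      ((w.length + 1) * (t + 4)) := by
  obtain ⟨m, hm, h_rep⟩ := rep_searchBody_spec hp le_rfl b
  have h_fill := (measure_spec x b w [] E 0 0).seq (rewind_spec _ _ _ _ _ _)
  have h_clear := clear_spec x (decide (∃ i ≤ w.length, P i)) w [] (Function.update E x m) 0 0
  have h_update : Function.update E x 0 = E := by rw [← hx, Function.update_eq_self]
  simp only [Function.update_self, Function.update_idem, hx, zero_add, h_update, List.append_nil,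
    List.reverse_reverse, List.length_reverse] at h_fill h_clear
  exact ((h_fill.seq h_rep).seq h_clear).mono (by linarith)

end EvalProgram

namespace WordFormula

open EvalProgram EvalStack
open Turing (TM2.Stmt TM2.Cfg TM2.stepAux)

variable {Γ : Type} {d M : ℕ}

section Program

variable [Inhabited Γ]

/-- The program that evaluates a formula. -/
def prog : ∀ {d : ℕ} (φ : WordFormula Γ d), φ.width ≤ M → EvalProgram Γ M
  | _, count p x y z, h => testCount p (Fin.castLE h x) (Fin.castLE h y) (Fin.castLE h z)
  | _, not φ, h => (φ.prog h).seq (assign Bool.not)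
  | _, and φ ψ, h =>
    (φ.prog ((le_max_left _ _).trans h)).seq (ψ.prog ((le_max_right _ _).trans h)).whenTrue
  | d, ex φ, h => search (φ.prog h) ⟨d, φ.le_width.trans h⟩

/-- A bound for the running time of the evaluation. -/
def time : ∀ {d : ℕ}, WordFormula Γ d → Polynomial ℕ
  | _, count _ _ _ _ => 8 * (.X + 1) + 1
  | _, not φ => φ.time + 1
  | _, and φ ψ => φ.time + (1 + ψ.time)
  | _, ex φ => (.X + 1) * (φ.time + 4)

theorem prog_spec {w : List Γ} (φ : WordFormula Γ d) (h : φ.width ≤ M) {e : Fin d → ℕ}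
    (he : ∀ i, e i ≤ w.length) (b : Bool) {β : Bool} (hβ : β = true ↔ φ.Eval w e) :
    (φ.prog h).Spec b (mem w [] (padZeros M e) 0 0) β (mem w [] (padZeros M e) 0 0)
      (φ.time.eval w.length) := by
  classical
  induction φ generalizing b β with
  | @count d p x y z =>
    have hd : d ≤ M := h
    have h_count := testCount_spec (Fin.castLE hd x) b (padZeros M e) p w (Fin.castLE hd y)
      (Fin.castLE hd z) (padZeros_le he)
    obtain rfl : β = decide ((w.take (e x)).countP p = e y + e z) := by
      rw [Bool.eq_iff_iff, hβ, decide_eq_true_iff, Eval]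
    simp only [padZeros_castLE] at h_count
    simp only [time, Polynomial.eval_add, Polynomial.eval_mul, Polynomial.eval_X,
      Polynomial.eval_one, Polynomial.eval_ofNat]
    exact h_count
  | not φ ih =>
    have h_not : (!β) = true ↔ φ.Eval w e := by
      rw [Bool.not_eq_true', ← Bool.not_eq_true, hβ, Eval, not_not]
    simpa [prog, time] using (ih h he b h_not).seq (assign_spec _ Bool.not _)
  | and φ ψ ih₁ ih₂ =>
    rw [time, Polynomial.eval_add, Polynomial.eval_add, Polynomial.eval_one]
    by_cases hφ : φ.Eval w e
    · have h₁ := ih₁ ((le_max_left _ _).trans h) he b (iff_of_true rfl hφ)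
      have h₂ := ih₂ ((le_max_right _ _).trans h) he true (hβ.trans (and_iff_right hφ))
      exact h₁.seq h₂.whenTrue_true
    · have h₁ := ih₁ ((le_max_left _ _).trans h) he b (β := false) (by simpa using hφ)
      obtain rfl : β = false := Bool.eq_false_iff.2 fun h => hφ (hβ.1 h).1
      exact (h₁.seq StackProgram.Spec.whenTrue_false).mono (by lia)
  | @ex d φ ih =>
    have hd : d < M := φ.le_width.trans h
    obtain rfl : β = decide (∃ i ≤ w.length, φ.Eval w (Fin.snoc e i)) := by
      rw [Bool.eq_iff_iff, hβ, decide_eq_true_iff, Eval]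
    have h_search := search_spec (x := ⟨d, hd⟩) (E := padZeros M e)
      (P := fun i => φ.Eval w (Fin.snoc e i)) (padZeros_of_le le_rfl)
      (fun i hi b => by
        rw [update_padZeros hd]
        exact ih h (Fin.lastCases (by simpa using hi) (by simpa using he)) b decide_eq_true_iff) b
    simpa [prog, time] using h_search

end Program

/-- The statement that empties the input and outputs the Boolean register. -/
def outputStmt {Λ : Type} (again : Λ) :
    TM2.Stmt (Alphabet Γ (M := M)) Λ (Bool × Option Γ × Bool) :=
  .pop inp (fun v o => (v.1, o, v.2.2)) (.branch (·.2.1.isSome) (.goto fun _ => again)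
    (.push out (fun v => v.1) (.load (fun _ => (false, none, false)) .halt)))

lemma stepAux_outputStmt_nil {Λ : Type} (again : Λ) (E : Fin M → ℕ) (b : Bool)
    (r : Option Γ × Bool) : TM2.stepAux (outputStmt again) (b, r) (mem [] [] E 0 0) =
      ⟨none, (false, none, false), Function.update (mem [] [] E 0 0) out [b]⟩ := by
  simp only [outputStmt, TM2.stepAux, head_inp, pop_inp, List.head?_nil, Option.isSome_none,
    cond_false, List.tail_nil]
  rfl

lemma stepAux_outputStmt_cons {Λ : Type} (again : Λ) (a : Γ) (w : List Γ) (E : Fin M → ℕ) (b : Bool)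
    (r : Option Γ × Bool) :
    TM2.stepAux (outputStmt again) (b, r) (mem (a :: w) [] E 0 0) =
      ⟨some again, (b, some a, r.2), mem w [] E 0 0⟩ := by
  simp [outputStmt, TM2.stepAux, head_inp, pop_inp]

variable [Inhabited Γ]

section Machine

variable [Fintype Γ]

/-- The machine that evaluates a formula on the word on its input stack. -/
def machine (φ : WordFormula Γ 0) : Turing.FinTM2 where
  K := EvalStack φ.width
  k₀ := inp
  k₁ := out
  Γ := Alphabet Γ
  Λ := Option (φ.prog (M := φ.width) le_rfl).Label
  main := some (φ.prog (M := φ.width) le_rfl).start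
  σ := Bool × Option Γ × Bool
  initialState := (false, none, false)
  Γk₀Fin := inferInstanceAs (Fintype Γ)
  m l := match l with
    | some l => (φ.prog le_rfl).code some none l
    | none => outputStmt none

variable (φ : WordFormula Γ 0) (w : List Γ)

lemma initList_machine : Turing.initList φ.machine w =
    (⟨some (some (φ.prog le_rfl).start), (false, none, false),
      mem w [] (padZeros φ.width Fin.elim0) 0 0⟩ : TM2.Cfg _ _ _) := by
  unfold Turing.initList
  congr 1
  funext k
  cases k <;> rfl

lemma haltList_machine (β : Bool) : Turing.haltList φ.machine [β] =
    (⟨none, (false, none, false),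
      Function.update (mem [] [] (padZeros φ.width Fin.elim0) 0 0) out [β]⟩ : TM2.Cfg _ _ _) := by
  unfold Turing.haltList
  congr 1
  funext k
  cases k <;> rfl

lemma output_runsTo (E : Fin φ.width → ℕ) (b : Bool) (r : Option Γ × Bool) :
    RunsTo φ.machine.m ⟨some none, (b, r), mem w [] E 0 0⟩
      ⟨none, (false, none, false), Function.update (mem [] [] E 0 0) out [b]⟩ (w.length + 1) := by
  induction w generalizing r with
  | nil => exact RunsTo.of_stepAux rfl (stepAux_outputStmt_nil _ E b r)
  | cons a w ih =>
    rw [List.length_cons, add_comm]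
    exact (RunsTo.of_stepAux (m := φ.machine.m) (l := none) rfl
      (stepAux_outputStmt_cons _ a w E b r)).trans (ih (some a, r.2))

lemma machine_runsTo {β : Bool} (hβ : β = true ↔ φ.Eval w Fin.elim0) :
    RunsTo φ.machine.m (Turing.initList φ.machine w) (Turing.haltList φ.machine [β])
      (φ.time.eval w.length + (w.length + 1)) := by
  obtain ⟨r, h⟩ := φ.prog_spec le_rfl (fun i => i.elim0) false hβ (none, false)
  rw [initList_machine, haltList_machine]
  exact (h _ some none φ.machine.m fun _ => rfl).trans (φ.output_runsTo w _ β r)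

end Machine

theorem inPolyTime [Finite Γ] {α : Type} {enc : α → List Γ} {L : Set α} (φ : WordFormula Γ 0)
    (h : ∀ a, a ∈ L ↔ φ.Eval (enc a) Fin.elim0) : InPolyTime enc L := by
  classical
  have := Fintype.ofFinite Γ
  refine ⟨fun a => decide (a ∈ L), ⟨?_⟩, fun a => decide_eq_true_iff⟩
  have h_run := fun a => φ.machine_runsTo (enc a) (decide_eq_true_iff.trans (h a))
  refine
    { tm := φ.machine
      inputAlphabet := Equiv.refl Γ
      outputAlphabet := Equiv.refl Bool
      time := φ.time + (.X + 1)
      outputsFun := fun a =>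
        { steps := (h_run a).choose
          evals_in_steps := ?_
          steps_le_m := ?_ } }
  · have h_enc : List.map (Equiv.refl Γ).invFun (enc a) = enc a := List.map_id _
    exact (congrArg (fun l => (flip bind φ.machine.step)^[(h_run a).choose]
      (some (Turing.initList φ.machine l))) h_enc).trans (h_run a).choose_spec.2
  · simpa using (h_run a).choose_spec.1

end WordFormula

lemma primrec_fin_snoc {d : ℕ} : Primrec₂ fun (e : Fin d → ℕ) (i : ℕ) =>
    (Fin.snoc e i : Fin (d + 1) → ℕ) := by
  refine Primrec.fin_curry.2 (Primrec₂.swap (Primrec.fin_curry₁.2 fun j => ?_))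
  induction j using Fin.lastCases with
  | last => simpa using Primrec.snd
  | cast j => simpa using Primrec.fin_app.comp Primrec.fst (Primrec.const j)

theorem WordFormula.primrecPred_eval {Γ : Type} [Finite Γ] [Primcodable Γ] {d : ℕ}
    (φ : WordFormula Γ d) : PrimrecPred fun q : List Γ × (Fin d → ℕ) => φ.Eval q.1 q.2 := by
  induction φ with
  | @count d p x y z =>
    have hp : PrimrecPred fun a : Γ => p a = true :=
      Primrec.eq.comp (Primrec.dom_finite p) (Primrec.const true)
    have h_var (x : Fin d) : Primrec fun q : List Γ × (Fin d → ℕ) => q.2 x :=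
      Primrec.fin_app.comp Primrec.snd (Primrec.const x)
    have h_count : Primrec fun q : List Γ × (Fin d → ℕ) => (q.1.take (q.2 x)).countP p :=
      (Primrec.list_length.comp ((Primrec.listFilter hp).comp
        (Primrec.list_take.comp (h_var x) Primrec.fst))).of_eq fun q => by
          simp only [List.countP_eq_length_filter, Bool.decide_eq_true]
    exact Primrec.eq.comp h_count (Primrec.nat_add.comp (h_var y) (h_var z))
  | not φ ih => exact ih.not
  | and φ ψ ih₁ ih₂ => exact ih₁.and ih₂
  | @ex d φ ih =>
    have h_body : PrimrecRel fun (i : ℕ) (q : List Γ × (Fin d → ℕ)) =>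
        φ.Eval q.1 (Fin.snoc q.2 i) :=
      ih.comp (Primrec.pair (Primrec.fst.comp Primrec.snd)
        (primrec_fin_snoc.comp (Primrec.snd.comp Primrec.snd) Primrec.fst))
    have h_range : Primrec fun q : List Γ × (Fin d → ℕ) => List.range (q.1.length + 1) :=
      Primrec.list_range.comp (Primrec.succ.comp (Primrec.list_length.comp Primrec.fst))
    exact (h_body.exists_mem_list.comp h_range Primrec.id).of_eq fun q => by
      simp only [WordFormula.Eval, List.mem_range, Nat.lt_succ_iff, id]

/-! ### Definable predicates on words -/

namespace WordFormula

variable {Γ : Type} {d d' : ℕ}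

/-- Renaming of the free variables. -/
def rename : ∀ {d d' : ℕ}, (Fin d → Fin d') → WordFormula Γ d → WordFormula Γ d'
  | _, _, ρ, count p x y z => count p (ρ x) (ρ y) (ρ z)
  | _, _, ρ, not φ => not (φ.rename ρ)
  | _, _, ρ, and φ ψ => and (φ.rename ρ) (ψ.rename ρ)
  | _, d', ρ, ex φ => ex (φ.rename (Fin.snoc (fun i => (ρ i).castSucc) (Fin.last d')))

lemma eval_rename (w : List Γ) (φ : WordFormula Γ d) (ρ : Fin d → Fin d') (e : Fin d' → ℕ) :
    (φ.rename ρ).Eval w e ↔ φ.Eval w fun i => e (ρ i) := by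
  induction φ generalizing d' with
  | count p x y z => rfl
  | not φ ih => exact not_congr (ih ..)
  | and φ ψ ih₁ ih₂ => exact and_congr (ih₁ ..) (ih₂ ..)
  | @ex d φ ih =>
    refine exists_congr fun j => and_congr_right fun _ => (ih ..).trans (iff_of_eq ?_)
    congr 1
    funext i
    cases i using Fin.lastCases <;> simp

/-- Predicates on words and numbers up to the length of the word that are defined by a formula. The
formula is found by instance search. -/
class Definable (R : List Γ → (Fin d → ℕ) → Prop) : Prop where
  exists_formula : ∃ φ : WordFormula Γ d, ∀ w e, (∀ i, e i ≤ w.length) → (φ.Eval w e ↔ R w e)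

/-- Numerical functions with a definable graph. Their values may exceed the length of the word. -/
class DefinableFun (t : List Γ → (Fin d → ℕ) → ℕ) : Prop where
  graph : Definable fun w (e : Fin (d + 1) → ℕ) => e (Fin.last d) = t w fun i => e i.castSucc

namespace Definable

variable {R R' : List Γ → (Fin d → ℕ) → Prop} {P : List Γ → (Fin d → ℕ) → ℕ → Prop}

lemma of_iff (R : List Γ → (Fin d → ℕ) → Prop) [h : Definable R]
    (hR : ∀ w e, (∀ i, e i ≤ w.length) → (R' w e ↔ R w e)) : Definable R' := by
  obtain ⟨φ, hφ⟩ := h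
  exact ⟨φ, fun w e he => (hφ w e he).trans (hR w e he).symm⟩

lemma comp (h : Definable R) (ρ : Fin d → Fin d') : Definable fun w e => R w fun i => e (ρ i) := by
  obtain ⟨φ, hφ⟩ := h
  exact ⟨φ.rename ρ, fun w e he => (eval_rename ..).trans (hφ w _ fun i => he (ρ i))⟩

instance not [h : Definable R] : Definable fun w e => ¬ R w e := by
  obtain ⟨φ, hφ⟩ := h
  exact ⟨.not φ, fun w e he => not_congr (hφ w e he)⟩

instance and [h : Definable R] [h' : Definable R'] : Definable fun w e => R w e ∧ R' w e := by
  obtain ⟨φ, hφ⟩ := h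
  obtain ⟨ψ, hψ⟩ := h'
  exact ⟨.and φ ψ, fun w e he => and_congr (hφ w e he) (hψ w e he)⟩

instance imp [Definable R] [Definable R'] : Definable fun w e => R w e → R' w e :=
  of_iff (fun w e => ¬ (R w e ∧ ¬ R' w e)) fun _ _ _ => by tauto

instance ex [h : Definable fun w (e : Fin (d + 1) → ℕ) =>
    P w (fun i => e i.castSucc) (e (Fin.last d))] :
    Definable fun w e => ∃ i ≤ w.length, P w e i := by
  obtain ⟨φ, hφ⟩ := h
  refine ⟨.ex φ, fun w e he => exists_congr fun i => and_congr_right fun hi => ?_⟩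
  rw [hφ]
  · simp only [Fin.snoc_castSucc, Fin.snoc_last]
  · intro j
    cases j using Fin.lastCases with
    | last => simpa using hi
    | cast j => simpa using he j

instance all [Definable fun w (e : Fin (d + 1) → ℕ) =>
    P w (fun i => e i.castSucc) (e (Fin.last d))] :
    Definable fun w e => ∀ i ≤ w.length, P w e i :=
  of_iff (fun w e => ¬ ∃ i ≤ w.length, ¬ P w e i) fun _ _ _ => by push Not; rfl

variable {i j k : Fin d}

lemma countP_take_eq_add (p : Γ → Bool) :
    Definable fun w e => (w.take (e i)).countP p = e j + e k :=
  ⟨.count p i j k, fun _ _ _ => Iff.rfl⟩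

lemma eq_zero : Definable fun (_ : List Γ) e => e i = 0 :=
  ⟨.count (fun _ => false) i i i, fun w e _ => by simp [Eval]; lia⟩

lemma eq_add : Definable fun (_ : List Γ) e => e i = e j + e k :=
  ⟨.count (fun _ => true) i j k, fun w e he => by simp [Eval, he i]⟩

instance le : Definable fun (_ : List Γ) e => e i ≤ e j :=
  have := @eq_add Γ (d + 1) j.castSucc i.castSucc (Fin.last d)
  of_iff (fun w e => ∃ k ≤ w.length, e j = e i + k) fun w e he =>
    ⟨fun h => ⟨e j - e i, (Nat.sub_le ..).trans (he j), by lia⟩, fun ⟨_, _, h⟩ => by lia⟩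

instance eq {t : List Γ → (Fin d → ℕ) → ℕ} [h : DefinableFun t] :
    Definable fun w e => e i = t w e := by
  simpa using h.graph.comp (Fin.snoc id i)

instance lt {t : List Γ → (Fin d → ℕ) → ℕ} [h : DefinableFun t] :
    Definable fun w e => e i < t w e :=
  have := h.graph
  of_iff (fun w e => ¬ ∃ j ≤ w.length, j = t w e ∧ j ≤ e i) fun _ e he =>
    ⟨fun h ⟨_, _, hj, h'⟩ => by lia, fun h => not_le.1 fun h' => h ⟨_, h'.trans (he i), rfl, h'⟩⟩

lemma subst (t : List Γ → (Fin d → ℕ) → ℕ) [h : DefinableFun t]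
    [Definable fun w (e : Fin (d + 1) → ℕ) => P w (fun i => e i.castSucc) (e (Fin.last d))]
    (hP : ∀ w e i, P w e i → i ≤ w.length) : Definable fun w e => P w e (t w e) :=
  have := h.graph
  of_iff (fun w e => ∃ i ≤ w.length, i = t w e ∧ P w e i) fun _ _ _ =>
    ⟨fun h => ⟨_, hP _ _ _ h, rfl, h⟩, fun ⟨_, _, hi, h⟩ => hi ▸ h⟩

end Definable

namespace DefinableFun

variable {s t : List Γ → (Fin d → ℕ) → ℕ}

lemma comp [h : DefinableFun t] (ρ : Fin d → Fin d') :
    DefinableFun fun w e => t w fun i => e (ρ i) :=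
  ⟨by simpa using h.graph.comp (Fin.snoc (fun i => (ρ i).castSucc) (Fin.last d'))⟩

instance var (i : Fin d) : DefinableFun fun (_ : List Γ) e => e i :=
  ⟨.of_iff (fun _ e => e (Fin.last d) ≤ e i.castSucc ∧ e i.castSucc ≤ e (Fin.last d))
    fun _ _ _ => le_antisymm_iff⟩

instance countP_take (p : Γ → Bool) (i : Fin d) : DefinableFun fun w e => (w.take (e i)).countP p :=
  have zero := @Definable.eq_zero Γ (d + 2) (Fin.last (d + 1))
  have count := Definable.countP_take_eq_add (i := i.castSucc.castSucc) (j := (Fin.last d).castSucc)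
    (k := Fin.last (d + 1)) p
  ⟨.of_iff (fun w e => ∃ z ≤ w.length, z = 0 ∧
    (w.take (e i.castSucc)).countP p = e (Fin.last d) + z) fun _ _ _ => by simp [eq_comm]⟩

instance length : DefinableFun fun (w : List Γ) (_ : Fin d → ℕ) => w.length :=
  ⟨.of_iff (fun w e => ∀ i ≤ w.length, i ≤ e (Fin.last d)) fun _ _ he =>
    ⟨fun h _ hi => h ▸ hi, fun h => (he _).antisymm (h _ le_rfl)⟩⟩

instance countP (p : Γ → Bool) : DefinableFun fun w (_ : Fin d → ℕ) => w.countP p :=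
  ⟨.of_iff (fun w e => ∃ i ≤ w.length, i = w.length ∧ e (Fin.last d) = (w.take i).countP p)
    fun _ _ _ => by simp⟩

instance add [DefinableFun s] [DefinableFun t] : DefinableFun fun w e => s w e + t w e :=
  have := comp (t := s) fun i => i.castSucc.castSucc
  have := comp (t := t) fun i => i.castSucc.castSucc.castSucc
  have := @Definable.eq_add Γ (d + 3) (Fin.last d).castSucc.castSucc (Fin.last (d + 1)).castSucc
    (Fin.last (d + 2))
  ⟨.of_iff (fun w e => ∃ j ≤ w.length, j = s w (fun i => e i.castSucc) ∧
    ∃ k ≤ w.length, k = t w (fun i => e i.castSucc) ∧ e (Fin.last d) = j + k) fun w e he =>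
    have h := he (Fin.last d)
    ⟨fun h' => ⟨_, by lia, rfl, _, by lia, rfl, h'⟩, fun ⟨_, _, hj, _, _, hk, h'⟩ => by lia⟩⟩

instance const : ∀ c : ℕ, DefinableFun fun (_ : List Γ) (_ : Fin d → ℕ) => c
  | 0 => ⟨Definable.eq_zero⟩
  | 1 =>
    have := @Definable.eq_zero Γ
    ⟨.of_iff (fun w e => ¬ e (Fin.last d) = 0 ∧ ∀ i ≤ w.length, i < e (Fin.last d) → i = 0)
      fun w e he => ⟨by lia, fun ⟨_, h⟩ => by
        by_contra h1
        have := h 1 ((by lia : 1 ≤ e (Fin.last d)).trans (he _)) (by lia)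
        lia⟩⟩
  | c + 2 =>
    have := const (c + 1)
    have := const 1
    inferInstanceAs (DefinableFun fun _ _ => (c + 1) + 1)

end DefinableFun

namespace Definable

variable {R : List Γ → ℕ → ℕ → Prop} {s t : List Γ → (Fin d → ℕ) → ℕ}

lemma subst₂ [DefinableFun s] [ht : DefinableFun t]
    (hR : Definable fun w (e : Fin 2 → ℕ) => R w (e 0) (e 1))
    (hle : ∀ {w i j}, R w i j → i ≤ w.length ∧ j ≤ w.length) :
    Definable fun w e => R w (s w e) (t w e) :=
  have : Definable fun w (e : Fin (d + 2) → ℕ) => R w (e (Fin.last d).castSucc) (e (Fin.last _)) :=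
    hR.comp ![(Fin.last d).castSucc, Fin.last (d + 1)]
  have := ht.comp Fin.castSucc
  have : Definable fun w e => R w (e (Fin.last d)) (t w fun i => e i.castSucc) :=
    subst (P := fun w e => R w (e (Fin.last d))) _ fun _ _ _ h => (hle h).2
  subst (P := fun w e i => R w i (t w e)) _ fun _ _ _ h => (hle h).1

end Definable

end WordFormula

/-! ### Words of blocks -/

namespace WordFormula

variable {Γ : Type} {d : ℕ}

/-- The letter at position `x` satisfies `p`. -/
def LetterAt (p : Γ → Bool) (w : List Γ) (x : ℕ) : Prop := ∃ a ∈ w[x]?, p a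

/-- Blocks end at the letters that satisfy `sep` and are numbered from `0`. The block number `b`
starts at position `s`. -/
def BlockStart (sep : Γ → Bool) (w : List Γ) (b s : ℕ) : Prop :=
  b = (w.take s).countP sep ∧ ∀ y ≤ w.length, y < s → ¬ b = (w.take y).countP sep

/-- The letter number `j` of the block number `b` satisfies `p`. -/
def BlockLetter (sep p : Γ → Bool) (w : List Γ) (b j : ℕ) : Prop :=
  ∃ s ≤ w.length, BlockStart sep w b s ∧
    ∃ x ≤ w.length, x = s + j ∧ b = (w.take x).countP sep ∧ LetterAt p w x

/-- Words that end with their only separator. -/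
def IsBlock (sep : Γ → Bool) (B : List Γ) : Prop :=
  ∃ l a, B = l ++ [a] ∧ (∀ c ∈ l, sep c = false) ∧ sep a = true

section

variable {p sep : Γ → Bool} {w B : List Γ} {x b s j : ℕ}

lemma LetterAt.lt_length (h : LetterAt p w x) : x < w.length := by
  obtain ⟨a, ha, -⟩ := h
  exact (List.getElem?_eq_some_iff.1 ha).1

lemma countP_take_succ_ne_iff :
    (w.take (x + 1)).countP p ≠ (w.take x).countP p ↔ LetterAt p w x := by
  rw [List.take_add_one, List.countP_append, LetterAt]
  cases w[x]? with
  | none => simp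
  | some a => by_cases hp : p a <;> simp [hp]

lemma countP_take_le (p : Γ → Bool) (w : List Γ) (x : ℕ) : (w.take x).countP p ≤ w.length :=
  (w.take_sublist x).countP_le.trans List.countP_le_length

lemma BlockLetter.le_length (h : BlockLetter sep p w b j) : b ≤ w.length ∧ j ≤ w.length := by
  obtain ⟨s, -, -, x, hx, rfl, rfl, -⟩ := h
  exact ⟨countP_take_le .., (Nat.le_add_left ..).trans hx⟩

instance definable_letterAt (p : Γ → Bool) (i : Fin d) :
    Definable fun w e => LetterAt p w (e i) :=
  .of_iff (fun w e => ∃ y ≤ w.length, y = e i + 1 ∧ ∃ c ≤ w.length, c = (w.take y).countP p ∧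
    ¬ c = (w.take (e i)).countP p) fun w e _ => by
    rw [← countP_take_succ_ne_iff]
    refine ⟨fun h => ⟨_, ?_, rfl, _, countP_take_le .., rfl, h⟩, ?_⟩
    · exact (countP_take_succ_ne_iff.1 h).lt_length
    · rintro ⟨_, -, rfl, _, -, rfl, h⟩
      exact h

instance definable_blockLetter (sep p : Γ → Bool) (s t : List Γ → (Fin d → ℕ) → ℕ)
    [DefinableFun s] [DefinableFun t] : Definable fun w e => BlockLetter sep p w (s w e) (t w e) :=
  .subst₂ (by unfold BlockLetter BlockStart; infer_instance) BlockLetter.le_length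

lemma letterAt_append_of_lt (hx : x < B.length) : LetterAt p (B ++ w) x ↔ LetterAt p B x := by
  rw [LetterAt, List.getElem?_append_left hx, LetterAt]

lemma letterAt_append_add : LetterAt p (B ++ w) (B.length + x) ↔ LetterAt p w x := by
  rw [LetterAt, List.getElem?_append_right (Nat.le_add_right ..), Nat.add_sub_cancel_left, LetterAt]

lemma blockStart_zero : BlockStart sep w 0 s ↔ s = 0 := by
  refine ⟨fun ⟨_, hs⟩ => ?_, ?_⟩
  · by_contra h0
    exact hs 0 (Nat.zero_le _) (Nat.pos_of_ne_zero h0) (by simp)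
  · rintro rfl
    exact ⟨by simp, fun y _ hy => absurd hy y.not_lt_zero⟩

namespace IsBlock

lemma length_pos (h : IsBlock sep B) : 0 < B.length := by
  obtain ⟨l, a, rfl, -⟩ := h
  simp

lemma countP_take_of_lt (h : IsBlock sep B) (hx : x < B.length) : (B.take x).countP sep = 0 := by
  obtain ⟨l, a, rfl, hl, -⟩ := h
  rw [List.length_append, List.length_singleton, Nat.lt_succ_iff] at hx
  rw [List.take_append_of_le_length hx, List.countP_eq_zero]
  exact fun c hc => by simp [hl c (List.mem_of_mem_take hc)]

lemma countP_eq_one (h : IsBlock sep B) : B.countP sep = 1 := by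
  obtain ⟨l, a, rfl, hl, ha⟩ := h
  rw [List.countP_append, List.countP_eq_zero.2 fun c hc => by simp [hl c hc]]
  simp [ha]

lemma letterAt_iff (h : IsBlock sep B) : LetterAt sep B x ↔ x + 1 = B.length := by
  rw [← countP_take_succ_ne_iff]
  rcases lt_trichotomy (x + 1) B.length with hx | hx | hx
  · simp [h.countP_take_of_lt hx, h.countP_take_of_lt (Nat.lt_of_succ_lt hx), hx.ne]
  · simp [hx, h.countP_take_of_lt (Nat.lt_of_succ_le hx.le), h.countP_eq_one]
  · simp [List.take_of_length_le hx.le, List.take_of_length_le (Nat.lt_succ_iff.1 hx), hx.ne']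

lemma countP_take_append_of_lt (h : IsBlock sep B) (hx : x < B.length) :
    ((B ++ w).take x).countP sep = 0 := by
  rw [List.take_append_of_le_length hx.le, h.countP_take_of_lt hx]

lemma countP_take_append_add (h : IsBlock sep B) :
    ((B ++ w).take (B.length + x)).countP sep = (w.take x).countP sep + 1 := by
  rw [List.take_length_add_append, List.countP_append, h.countP_eq_one, add_comm]

lemma blockLetter_append_zero (h : IsBlock sep B) :
    BlockLetter sep p (B ++ w) 0 j ↔ LetterAt p B j := by
  have hlt : 0 = ((B ++ w).take j).countP sep ↔ j < B.length := by
    refine ⟨fun hj => ?_, fun hj => (h.countP_take_append_of_lt hj).symm⟩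
    by_contra! hle
    obtain ⟨i, rfl⟩ := Nat.exists_eq_add_of_le hle
    rw [h.countP_take_append_add] at hj
    lia
  simp only [BlockLetter, blockStart_zero]
  constructor
  · rintro ⟨_, -, rfl, _, -, rfl, hj, hp⟩
    rw [zero_add] at hj hp
    exact (letterAt_append_of_lt (hlt.1 hj)).1 hp
  · intro hp
    have hj := hp.lt_length
    have hp' := (letterAt_append_of_lt (w := w) hj).2 hp
    exact ⟨0, Nat.zero_le _, rfl, j, hp'.lt_length.le, (zero_add j).symm, hlt.2 hj, hp'⟩

lemma blockStart_append_succ (h : IsBlock sep B) : BlockStart sep (B ++ w) (b + 1) s ↔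
    ∃ s', s = B.length + s' ∧ BlockStart sep w b s' := by
  constructor
  · rintro ⟨hb, hmin⟩
    rcases lt_or_ge s B.length with hs | hs
    · rw [h.countP_take_append_of_lt hs] at hb
      lia
    obtain ⟨s', rfl⟩ := Nat.exists_eq_add_of_le hs
    rw [h.countP_take_append_add] at hb
    refine ⟨s', rfl, Nat.succ_injective hb, fun y hy hys hby => ?_⟩
    refine hmin (B.length + y) (by rw [List.length_append]; lia) (by lia) ?_
    rw [h.countP_take_append_add, hby]
  · rintro ⟨s', rfl, rfl, hmin⟩
    refine ⟨h.countP_take_append_add.symm, fun y hy hys hby => ?_⟩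
    rcases lt_or_ge y B.length with hyB | hyB
    · rw [h.countP_take_append_of_lt hyB] at hby
      lia
    · obtain ⟨y, rfl⟩ := Nat.exists_eq_add_of_le hyB
      rw [h.countP_take_append_add] at hby
      rw [List.length_append] at hy
      exact hmin y (by lia) (by lia) (Nat.succ_injective hby)

lemma blockLetter_append_succ (h : IsBlock sep B) :
    BlockLetter sep p (B ++ w) (b + 1) j ↔ BlockLetter sep p w b j := by
  simp only [BlockLetter, h.blockStart_append_succ, List.length_append]
  constructor
  · rintro ⟨_, hs, ⟨s, rfl, hbs⟩, _, hx, rfl, hb, hp⟩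
    rw [add_assoc, letterAt_append_add] at hp
    rw [add_assoc, h.countP_take_append_add] at hb
    exact ⟨s, by lia, hbs, s + j, by lia, rfl, Nat.succ_injective hb, hp⟩
  · rintro ⟨s, hs, hbs, _, hx, rfl, hb, hp⟩
    refine ⟨B.length + s, by lia, ⟨s, rfl, hbs⟩, B.length + (s + j), by lia,
      (add_assoc ..).symm, ?_, letterAt_append_add.2 hp⟩
    rw [h.countP_take_append_add, ← hb]

end IsBlock

lemma blockLetter_flatten {Bs : List (List Γ)} (hBs : ∀ B ∈ Bs, IsBlock sep B) :
    BlockLetter sep p Bs.flatten b j ↔ ∃ B ∈ Bs[b]?, LetterAt p B j := by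
  induction Bs generalizing b with
  | nil =>
    refine ⟨fun ⟨_, _, _, _, _, _, _, h⟩ => ?_, fun ⟨B, hB, _⟩ => by simp at hB⟩
    exact absurd h.lt_length (Nat.not_lt_zero _)
  | cons B Bs ih =>
    obtain ⟨hB, hBs⟩ := List.forall_mem_cons.1 hBs
    cases b with
    | zero => simpa using hB.blockLetter_append_zero
    | succ b => exact hB.blockLetter_append_succ.trans (ih hBs)

lemma letterAt_sep_flatten {Bs : List (List Γ)} (hBs : ∀ B ∈ Bs, IsBlock sep B)
    (hx : x + 1 = Bs.flatten.length) : LetterAt sep Bs.flatten x := by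
  rcases List.eq_nil_or_concat' Bs with rfl | ⟨Bs, B, rfl⟩
  · exact absurd hx x.succ_ne_zero
  · have hB := hBs B (by simp)
    rw [List.flatten_append, List.flatten_singleton] at hx ⊢
    rw [List.length_append] at hx
    obtain ⟨y, rfl⟩ := Nat.exists_eq_add_of_le
      (show Bs.flatten.length ≤ x by have := hB.length_pos; lia)
    exact letterAt_append_add.2 (hB.letterAt_iff.2 (by lia))

end

end WordFormula

/-! ### The formula for certificates -/

/-- The alphabet of the words that present pairs of an instance and a candidate certificate. -/
abbrev PairLetter : Type := Option Bool ⊕ Option Bool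

namespace PairLetter

open WordFormula

/-- The separators. -/
def isSep : PairLetter → Bool
  | .inl none | .inr none => true
  | _ => false

/-- The separators in the instance. -/
def isRowSep : PairLetter → Bool
  | .inl none => true
  | _ => false

/-- The bit `1` in the instance. -/
def isOne : PairLetter → Bool
  | .inl (some true) => true
  | _ => false

/-- The letter that does not occur in unary words. -/
def isCertZero : PairLetter → Bool
  | .inr (some false) => true
  | _ => false

/-- The number of vertices of the instance. -/
def numRows (w : List PairLetter) : ℕ := w.countP isRowSep

/-- The bit `j` in the row of `u` is `1`. The bits `0` to `3` tell whether `u` belongs to `V_P`,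
`T`, `W` and `{v}`, and the bit `u' + 4` whether `u'` is a successor of `u`. -/
def RowBit (w : List PairLetter) (u j : ℕ) : Prop := BlockLetter isSep isOne w u j

/-- The entry `i` of the list of unary numbers behind the instance is `q`. -/
def NumberAt (w : List PairLetter) (i q : ℕ) : Prop := BlockLetter isSep isSep w (numRows w + i) q

/-- The vertex `u` belongs to the block `i` of the partition. -/
def PartAt (w : List PairLetter) (u i : ℕ) : Prop := u < numRows w ∧ NumberAt w (u + 1) i

/-- The vertex number `b` of the path is `q`. -/
def PathAt (w : List PairLetter) (b q : ℕ) : Prop := NumberAt w (numRows w + b + 1) q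

/-- All the words behind the instance are unary. -/
def IsUnary (w : List PairLetter) : Prop :=
  (∀ x ≤ w.length, ¬ LetterAt isCertZero w x) ∧
  ∀ x ≤ w.length, ∀ y ≤ w.length, y = x + 1 → y = w.length → LetterAt isSep w x

/-- The numbers behind the instance present a candidate certificate with the maximal index `k`. -/
def IsCandidate (w : List PairLetter) (k : ℕ) : Prop :=
  NumberAt w 0 k ∧ (∀ u ≤ w.length, u < numRows w → ∃ i ≤ w.length, PartAt w u i ∧ i ≤ k) ∧
    ∀ b ≤ w.length, ∀ q ≤ w.length, PathAt w b q → q < numRows w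

/-- The partition is a drift partition; see `TargetArena.isDriftPartition_iff`. -/
def IsDrift (w : List PairLetter) (k : ℕ) : Prop :=
  (∀ i ≤ w.length, i ≤ k → ∃ u ≤ w.length, ∃ j ≤ w.length, PartAt w u j ∧ j = i) ∧
  ∀ u ≤ w.length, ∀ i ≤ w.length, PartAt w u i →
    ∀ u' ≤ w.length, ∀ i' ≤ w.length, PartAt w u' i' → RowBit w u (u' + 4) → i < i' →
      ¬ RowBit w u 0 ∧
        ∃ u' ≤ w.length, ∃ i' ≤ w.length, PartAt w u' i' ∧ RowBit w u (u' + 4) ∧ i' < i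

/-- The path is a simple path to the target set; see
`TargetArena.isSimplePathToTarget_iff_getElem?`. -/
def IsPath (w : List PairLetter) : Prop :=
  (∀ b ≤ w.length, ∀ q ≤ w.length, PathAt w b q →
    ∀ b' ≤ w.length, ∀ q' ≤ w.length, PathAt w b' q' → b' = b + 1 → RowBit w q (q' + 4)) ∧
  (∀ b ≤ w.length, ∀ q ≤ w.length, PathAt w b q →
    ∀ b' ≤ w.length, ∀ q' ≤ w.length, PathAt w b' q' → q = q' → b = b') ∧
  (∃ b ≤ w.length, ∃ q ≤ w.length, PathAt w b q ∧ b = 0 ∧ RowBit w q 3) ∧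
  ∃ b ≤ w.length, ∃ q ≤ w.length, PathAt w b q ∧
    (∀ b' ≤ w.length, ∀ q' ≤ w.length, PathAt w b' q' → b' ≤ b) ∧ RowBit w q 1

/-- The word presents an instance and a valid certificate. -/
def IsCertified (w : List PairLetter) : Prop :=
  IsUnary w ∧ ∃ k ≤ w.length, IsCandidate w k ∧ IsDrift w k ∧ IsPath w ∧
    (∀ b ≤ w.length, ∀ q ≤ w.length, PathAt w b q → PartAt w q k) ∧
    (∀ u ≤ w.length, ∀ i ≤ w.length, PartAt w u i → RowBit w u 1 → i = k) ∧
    ∀ u ≤ w.length, ∀ i ≤ w.length, PartAt w u i → RowBit w u 2 → i < k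

section

variable {d : ℕ} (s t : List PairLetter → (Fin d → ℕ) → ℕ)

instance definableFun_numRows : DefinableFun fun w (_ : Fin d → ℕ) => numRows w :=
  DefinableFun.countP isRowSep

instance definable_rowBit [DefinableFun s] [DefinableFun t] :
    Definable fun w e => RowBit w (s w e) (t w e) := by
  unfold RowBit; infer_instance

instance definable_numberAt [DefinableFun s] [DefinableFun t] :
    Definable fun w e => NumberAt w (s w e) (t w e) := by
  unfold NumberAt; infer_instance

instance definable_partAt (i : Fin d) [DefinableFun t] :
    Definable fun w e => PartAt w (e i) (t w e) := by
  unfold PartAt; infer_instance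

instance definable_pathAt [DefinableFun s] [DefinableFun t] :
    Definable fun w e => PathAt w (s w e) (t w e) := by
  unfold PathAt; infer_instance

instance definable_isUnary : Definable fun w (_ : Fin d → ℕ) => IsUnary w := by
  unfold IsUnary; infer_instance

instance definable_isCandidate (i : Fin d) : Definable fun w e => IsCandidate w (e i) := by
  unfold IsCandidate; infer_instance

instance definable_isDrift (i : Fin d) : Definable fun w e => IsDrift w (e i) := by
  unfold IsDrift; infer_instance

instance definable_isPath : Definable fun w (_ : Fin d → ℕ) => IsPath w := by
  unfold IsPath; infer_instance

end

lemma exists_wordFormula :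
    ∃ φ : WordFormula PairLetter 0, ∀ w, φ.Eval w Fin.elim0 ↔ IsCertified w := by
  have : Definable fun w (_ : Fin 0 → ℕ) => IsCertified w := by
    unfold IsCertified; infer_instance
  obtain ⟨φ, hφ⟩ := this.exists_formula
  exact ⟨φ, fun w => hφ w _ fun i => i.elim0⟩

end PairLetter

/-! ### Words of instances with lists of numbers -/

lemma exists_eq_flatten_unaryWord_append {y : List (Option Bool)} (h : some false ∉ y) :
    ∃ (l : List ℕ) (m : ℕ), y = (l.map unaryWord).flatten ++ List.replicate m (some true) := by
  induction y using List.reverseRecOn with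
  | nil => exact ⟨[], 0, rfl⟩
  | append_singleton y a ih =>
    obtain ⟨l, m, rfl⟩ := ih fun h' => h (List.mem_append_left _ h')
    match a with
    | none => exact ⟨l ++ [m], 0, by simp [unaryWord]⟩
    | some true => exact ⟨l, m + 1, by rw [List.replicate_succ', List.append_assoc]⟩
    | some false => exact absurd (List.mem_append_right _ (List.mem_singleton_self _)) h

open scoped Classical in
/-- The row of a vertex in the encoding of an instance. -/
def NWRInstance.row (x : NWRInstance) (u : Fin x.n) : List (Option Bool) :=
  [some (decide (u ∈ x.arena.VP)), some (decide (u ∈ x.arena.T)),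
    some (decide (u ∈ x.W)), some (decide (u = x.v))] ++
    (List.ofFn fun w : Fin x.n => some (decide (x.arena.E u w))) ++ [none]

lemma NWRInstance.encode_eq (x : NWRInstance) : x.encode = (List.ofFn x.row).flatten := rfl

namespace PairLetter

open WordFormula

/-- The word of an instance and a list of numbers. -/
def pairWord (x : NWRInstance) (l : List ℕ) : List PairLetter :=
  x.encode.map Sum.inl ++ (l.map unaryWord).flatten.map Sum.inr

/-- The blocks of the word of an instance and a list of numbers. -/
def blocks (x : NWRInstance) (l : List ℕ) : List (List PairLetter) :=
  (List.ofFn fun u => (x.row u).map Sum.inl) ++ l.map fun q => (unaryWord q).map Sum.inr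

variable {x : NWRInstance} {l : List ℕ}

lemma flatten_blocks (x : NWRInstance) (l : List ℕ) : (blocks x l).flatten = pairWord x l := by
  rw [blocks, pairWord, List.flatten_append, x.encode_eq, List.map_flatten, List.map_flatten,
    List.map_map, List.map_ofFn]
  rfl

lemma isBlock_row (u : Fin x.n) : IsBlock isSep ((x.row u).map Sum.inl) := by
  refine ⟨_, .inl none, List.map_append, fun c hc => ?_, rfl⟩
  simp only [List.map_append, List.map_cons, List.map_nil, List.mem_append, List.mem_cons,
    List.not_mem_nil, or_false, List.map_ofFn, List.mem_ofFn] at hc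
  obtain (rfl | rfl | rfl | rfl) | ⟨_, rfl⟩ := hc <;> rfl

lemma isBlock_unaryWord (q : ℕ) : IsBlock isSep ((unaryWord q).map Sum.inr) := by
  refine ⟨_, .inr none, List.map_append, fun c hc => ?_, rfl⟩
  rw [List.map_replicate] at hc
  exact List.eq_of_mem_replicate hc ▸ rfl

lemma isBlock_of_mem_blocks : ∀ B ∈ blocks x l, IsBlock isSep B := by
  intro B hB
  rw [blocks, List.mem_append, List.mem_ofFn, List.mem_map] at hB
  obtain ⟨u, rfl⟩ | ⟨q, -, rfl⟩ := hB
  · exact isBlock_row u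
  · exact isBlock_unaryWord q

lemma countP_isRowSep_row (u : Fin x.n) : ((x.row u).map Sum.inl).countP isRowSep = 1 := by
  rw [← (isBlock_row u).countP_eq_one, List.countP_map, List.countP_map]
  exact List.countP_congr fun | none, _ | some _, _ => Iff.rfl

lemma countP_isRowSep_unaryWord (q : ℕ) : ((unaryWord q).map Sum.inr).countP isRowSep = 0 := by
  rw [List.countP_map, List.countP_eq_zero]
  rintro (_ | _) - <;> exact Bool.false_ne_true

lemma numRows_pairWord (x : NWRInstance) (l : List ℕ) : numRows (pairWord x l) = x.n := by
  rw [numRows, ← flatten_blocks, List.countP_flatten, blocks, List.map_append, List.sum_append,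
    List.map_ofFn, List.map_map]
  simp only [Function.comp_def, countP_isRowSep_row, countP_isRowSep_unaryWord]
  simp

lemma numberAt_pairWord {i q : ℕ} : NumberAt (pairWord x l) i q ↔ l[i]? = some q := by
  have unary (r : ℕ) : LetterAt isSep ((unaryWord r).map Sum.inr) q ↔ r = q := by
    rw [(isBlock_unaryWord r).letterAt_iff]
    simp [unaryWord, eq_comm]
  rw [NumberAt, numRows_pairWord, ← flatten_blocks, blockLetter_flatten isBlock_of_mem_blocks,
    blocks, List.getElem?_append_right (by simp)]
  simp [unary]

lemma rowBit_pairWord {u : Fin x.n} {j : ℕ} :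
    RowBit (pairWord x l) u j ↔ (x.row u)[j]? = some (some true) := by
  have isOne_iff : ∀ a, isOne (.inl a) = true ↔ a = some true
    | none | some true | some false => by simp [isOne]
  rw [RowBit, ← flatten_blocks, blockLetter_flatten isBlock_of_mem_blocks, blocks,
    List.getElem?_append_left (by simp)]
  simp [LetterAt, isOne_iff]

section Bits

variable {u : Fin x.n}

lemma rowBit_zero : RowBit (pairWord x l) u 0 ↔ u ∈ x.arena.VP := by
  simp [rowBit_pairWord, NWRInstance.row]

lemma rowBit_one : RowBit (pairWord x l) u 1 ↔ u ∈ x.arena.T := by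
  simp [rowBit_pairWord, NWRInstance.row]

lemma rowBit_two : RowBit (pairWord x l) u 2 ↔ u ∈ x.W := by
  simp [rowBit_pairWord, NWRInstance.row]

lemma rowBit_three : RowBit (pairWord x l) u 3 ↔ u = x.v := by
  simp [rowBit_pairWord, NWRInstance.row]

lemma rowBit_add_four {u' : Fin x.n} : RowBit (pairWord x l) u (u' + 4) ↔ x.arena.E u u' := by
  simp [rowBit_pairWord, NWRInstance.row]

end Bits

lemma isUnary_pairWord (x : NWRInstance) (l : List ℕ) : IsUnary (pairWord x l) := by
  refine ⟨?_, fun y _ _ _ hy hlen => ?_⟩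
  · rintro y - ⟨a, ha, hzero⟩
    have hmem := List.mem_of_getElem? ha
    simp only [pairWord, List.mem_append, List.mem_map, List.mem_flatten] at hmem
    obtain ⟨_, -, rfl⟩ | ⟨_, ⟨_, ⟨q, -, rfl⟩, hb⟩, rfl⟩ := hmem
    · exact Bool.false_ne_true hzero
    · rw [unaryWord, List.mem_append, List.mem_replicate, List.mem_singleton] at hb
      obtain ⟨-, rfl⟩ | rfl := hb <;> exact Bool.false_ne_true hzero
  · rw [← flatten_blocks] at hlen ⊢
    exact letterAt_sep_flatten isBlock_of_mem_blocks (hy.symm.trans hlen)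

lemma exists_eq_flatten_of_isUnary {z y : List (Option Bool)}
    (h : IsUnary (z.map Sum.inl ++ y.map Sum.inr)) :
    ∃ l : List ℕ, y = (l.map unaryWord).flatten := by
  have no_zero : some false ∉ y := fun hy => by
    obtain ⟨i, hi⟩ := List.mem_iff_getElem?.1 hy
    have : LetterAt isCertZero (z.map Sum.inl ++ y.map Sum.inr) ((z.map Sum.inl).length + i) :=
      letterAt_append_add.2 ⟨.inr (some false), by simp [hi], rfl⟩
    exact h.1 _ this.lt_length.le this
  obtain ⟨l, m, rfl⟩ := exists_eq_flatten_unaryWord_append no_zero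
  cases m with
  | zero => exact ⟨l, List.append_nil _⟩
  | succ m =>
    exfalso
    rw [List.replicate_succ', ← List.append_assoc, List.map_append, ← List.append_assoc] at h
    obtain ⟨a, ha, hsep⟩ := h.2 _ (by simp) _ le_rfl List.length_append rfl
    rw [List.map_singleton, List.getElem?_concat_length] at ha
    obtain rfl : Sum.inr (some true) = a := Option.some_inj.1 ha
    exact Bool.false_ne_true hsep

end PairLetter

/-! ### Certificates as lists of numbers -/

section Lists

variable {α : Type*} {l : List α} {a : α}

lemma isChain_iff_forall_getElem? {R : α → α → Prop} : l.IsChain R ↔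
    ∀ (i : ℕ) a, l[i]? = some a → ∀ (j : ℕ) b, l[j]? = some b → j = i + 1 → R a b := by
  refine List.isChain_iff_getElem.trans ⟨fun h i a ha j b hb hij => ?_, fun h i hi =>
    h i _ (List.getElem?_eq_getElem _) _ _ (List.getElem?_eq_getElem hi) rfl⟩
  subst hij
  obtain ⟨-, rfl⟩ := List.getElem?_eq_some_iff.1 ha
  obtain ⟨hi, rfl⟩ := List.getElem?_eq_some_iff.1 hb
  exact h i hi

lemma nodup_iff_forall_getElem? : l.Nodup ↔
    ∀ (i : ℕ) a, l[i]? = some a → ∀ (j : ℕ) b, l[j]? = some b → a = b → i = j := by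
  refine ⟨fun h i a ha j b hb hab => ?_, fun h =>
    List.nodup_iff_getElem?_ne_getElem?.2 fun i j hlt hj heq => hlt.ne ?_⟩
  · subst hab
    exact (List.getElem?_inj (List.getElem?_eq_some_iff.1 ha).1 h).1 (ha.trans hb.symm)
  · have hb := List.getElem?_eq_getElem hj
    exact h i _ (heq.trans hb) j _ hb rfl

lemma getLast?_eq_some_iff_exists_getElem? : l.getLast? = some a ↔
    ∃ i : ℕ, l[i]? = some a ∧ ∀ (j : ℕ) b, l[j]? = some b → j ≤ i := by
  rw [List.getLast?_eq_getElem?]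
  refine ⟨fun h => ⟨_, h, fun j b hb => ?_⟩, fun ⟨i, ha, le_i⟩ => ?_⟩
  · exact Nat.le_sub_one_of_lt (List.getElem?_eq_some_iff.1 hb).1
  · have hlt := (List.getElem?_eq_some_iff.1 ha).1
    have := le_i _ _ (List.getElem?_eq_getElem (Nat.sub_one_lt_of_lt hlt))
    rwa [← (Nat.le_sub_one_of_lt hlt).antisymm this]

end Lists

lemma TargetArena.isSimplePathToTarget_iff_getElem? {V : Type} {A : TargetArena V} {v : V}
    {π : List V} : A.IsSimplePathToTarget v π ↔
      (∀ (b : ℕ) q, π[b]? = some q → ∀ (b' : ℕ) q', π[b']? = some q' → b' = b + 1 → A.E q q') ∧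
      (∀ (b : ℕ) q, π[b]? = some q → ∀ (b' : ℕ) q', π[b']? = some q' → q = q' → b = b') ∧
      (∃ (b : ℕ) (q : V), π[b]? = some q ∧ b = 0 ∧ q = v) ∧
      ∃ (b : ℕ) (q : V), π[b]? = some q ∧ (∀ (b' : ℕ) q', π[b']? = some q' → b' ≤ b) ∧ q ∈ A.T := by
  have head : π.head? = some v ↔ ∃ (b : ℕ) (q : V), π[b]? = some q ∧ b = 0 ∧ q = v := by
    simp [List.head?_eq_getElem?]
  have last : (∃ t ∈ A.T, π.getLast? = some t) ↔ ∃ (b : ℕ) (q : V), π[b]? = some q ∧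
      (∀ (b' : ℕ) q', π[b']? = some q' → b' ≤ b) ∧ q ∈ A.T := by
    simp only [getLast?_eq_some_iff_exists_getElem?]
    exact ⟨fun ⟨t, ht, b, hb, h⟩ => ⟨b, t, hb, h, ht⟩, fun ⟨b, t, hb, h, ht⟩ => ⟨t, ht, b, hb, h⟩⟩
  rw [← isChain_iff_forall_getElem?, ← nodup_iff_forall_getElem?, ← head, ← last]
  exact ⟨fun ⟨h₁, h₂, h₃, h₄⟩ => ⟨h₁, h₂, h₃, h₄⟩, fun ⟨h₁, h₂, h₃, h₄⟩ => ⟨h₁, h₂, h₃, h₄⟩⟩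

namespace Certificate

variable {n : ℕ} (c : Certificate (Fin n))

/-- The numbers by which a certificate is presented. -/
def toList : List ℕ :=
  c.k :: (List.ofFn fun u => (c.part u : ℕ)) ++ c.path.map Fin.val

lemma encode_eq : c.encode = (c.toList.map unaryWord).flatten := by
  have h : (do let a ← c.path; pure (a : ℕ)) = c.path.map Fin.val := by
    rw [List.bind_eq_flatMap, List.map_eq_flatMap]
    rfl
  simp only [encode, toList, List.cons_append, List.map_cons, List.map_append, h,
    List.flatten_cons, List.flatten_append, List.map_ofFn, List.append_assoc]
  rfl

lemma toList_zero : c.toList[0]? = some c.k := rfl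

lemma toList_part (u : Fin n) : c.toList[(u : ℕ) + 1]? = some (c.part u : ℕ) := by
  rw [toList, List.cons_append, List.getElem?_cons_succ, List.getElem?_append_left (by simp)]
  simp

lemma toList_path (b : ℕ) : c.toList[n + b + 1]? = c.path[b]?.map Fin.val := by
  rw [toList, List.cons_append, List.getElem?_cons_succ, List.getElem?_append_right (by simp)]
  simp

end Certificate

namespace PairLetter

open WordFormula

section

variable {w : List PairLetter} {b u i q : ℕ}

lemma NumberAt.le_length (h : NumberAt w i q) : i ≤ w.length ∧ q ≤ w.length :=
  (BlockLetter.le_length h).imp_left (Nat.le_add_left ..).trans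

lemma PartAt.le_length (h : PartAt w u i) : u ≤ w.length ∧ i ≤ w.length :=
  h.2.le_length.imp_left (Nat.le_succ _).trans

lemma PathAt.le_length (h : PathAt w b q) : b ≤ w.length ∧ q ≤ w.length :=
  (NumberAt.le_length h).imp_left fun h => by lia

end

variable {x : NWRInstance}

lemma encodeWithCertificate_eq (c : Certificate (Fin x.n)) :
    encodeWithCertificate ⟨x, c⟩ = pairWord x c.toList := by
  rw [encodeWithCertificate, pairWord, Certificate.encode_eq]

lemma exists_eq_toList {l : List ℕ} {k : ℕ} (h : IsCandidate (pairWord x l) k) :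
    ∃ c : Certificate (Fin x.n), l = c.toList := by
  obtain ⟨hk, hpart, hpath⟩ := h
  have part_spec (u : Fin x.n) : ∃ i : Fin (k + 1), l[(u : ℕ) + 1]? = some (i : ℕ) := by
    have hu : (u : ℕ) < numRows (pairWord x l) := (numRows_pairWord x l).symm ▸ u.2
    obtain ⟨i, -, hi, hik⟩ := hpart u (hu.le.trans List.countP_le_length) hu
    exact ⟨⟨i, Nat.lt_succ_of_le hik⟩, numberAt_pairWord.1 hi.2⟩
  choose part part_spec using part_spec
  have lt_n : ∀ q ∈ l.drop (x.n + 1), q < x.n := fun q hq => by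
    obtain ⟨b, hb⟩ := List.mem_iff_getElem?.1 hq
    have hq : PathAt (pairWord x l) b q := by
      rw [PathAt, numberAt_pairWord, numRows_pairWord, ← hb, List.getElem?_drop, add_right_comm]
    exact numRows_pairWord x l ▸ hpath b hq.le_length.1 q hq.le_length.2 hq
  refine ⟨⟨k, part, (l.drop (x.n + 1)).pmap Fin.mk lt_n⟩, List.ext_getElem? fun i => ?_⟩
  rcases i with - | i
  · exact numberAt_pairWord.1 hk
  rcases lt_or_ge i x.n with hi | hi
  · exact (part_spec ⟨i, hi⟩).trans (Certificate.toList_part ⟨k, part, _⟩ ⟨i, hi⟩).symm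
  · obtain ⟨b, rfl⟩ := Nat.exists_eq_add_of_le hi
    rw [Certificate.toList_path, ← List.getElem?_map, List.map_pmap, List.pmap_eq_map,
      List.map_id', List.getElem?_drop, add_right_comm]

variable {c : Certificate (Fin x.n)}

lemma partAt_toList {u : Fin x.n} {i : ℕ} :
    PartAt (pairWord x c.toList) u i ↔ (c.part u : ℕ) = i := by
  rw [PartAt, numberAt_pairWord, numRows_pairWord, c.toList_part, Option.some_inj]
  exact and_iff_right u.2

lemma pathAt_toList {b q : ℕ} :
    PathAt (pairWord x c.toList) b q ↔ ∃ a, c.path[b]? = some a ∧ (a : ℕ) = q := by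
  rw [PathAt, numberAt_pairWord, numRows_pairWord, c.toList_path, Option.map_eq_some_iff]

section Quantifiers

variable {P : ℕ → ℕ → Prop}

lemma forall_partAt_toList : (∀ u ≤ (pairWord x c.toList).length,
    ∀ i ≤ (pairWord x c.toList).length, PartAt (pairWord x c.toList) u i → P u i) ↔
      ∀ u : Fin x.n, P u (c.part u) := by
  constructor
  · intro h u
    have hu := partAt_toList.2 (rfl : (c.part u : ℕ) = _)
    exact h u hu.le_length.1 _ hu.le_length.2 hu
  · intro h u _ i _ hu
    lift u to Fin x.n using numRows_pairWord x c.toList ▸ hu.1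
    exact partAt_toList.1 hu ▸ h u

lemma exists_partAt_toList : (∃ u ≤ (pairWord x c.toList).length,
    ∃ i ≤ (pairWord x c.toList).length, PartAt (pairWord x c.toList) u i ∧ P u i) ↔
      ∃ u : Fin x.n, P u (c.part u) := by
  rw [← not_iff_not]
  push Not
  exact forall_partAt_toList

lemma forall_pathAt_toList : (∀ b ≤ (pairWord x c.toList).length,
    ∀ q ≤ (pairWord x c.toList).length, PathAt (pairWord x c.toList) b q → P b q) ↔
      ∀ (b : ℕ) (q : Fin x.n), c.path[b]? = some q → P b q := by
  constructor
  · intro h b q hq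
    have hb := pathAt_toList.2 ⟨q, hq, rfl⟩
    exact h b hb.le_length.1 _ hb.le_length.2 hb
  · intro h b _ q _ hb
    obtain ⟨q, hq, rfl⟩ := pathAt_toList.1 hb
    exact h b q hq

lemma exists_pathAt_toList : (∃ b ≤ (pairWord x c.toList).length,
    ∃ q ≤ (pairWord x c.toList).length, PathAt (pairWord x c.toList) b q ∧ P b q) ↔
      ∃ (b : ℕ) (q : Fin x.n), c.path[b]? = some q ∧ P b q := by
  rw [← not_iff_not]
  push Not
  exact forall_pathAt_toList

end Quantifiers

lemma isCandidate_toList {k : ℕ} : IsCandidate (pairWord x c.toList) k ↔ c.k = k := by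
  rw [IsCandidate, numberAt_pairWord, c.toList_zero, Option.some_inj, forall_pathAt_toList,
    numRows_pairWord]
  refine and_iff_left_of_imp ?_
  rintro rfl
  refine ⟨fun u _ hu => ?_, fun _ q _ => q.2⟩
  have hpart := partAt_toList.2 (rfl : (c.part ⟨u, hu⟩ : ℕ) = _)
  exact ⟨_, hpart.le_length.2, hpart, Fin.is_le _⟩

lemma isDrift_toList : IsDrift (pairWord x c.toList) c.k ↔ x.arena.IsDriftPartition c.part := by
  have hk := (numberAt_pairWord.2 c.toList_zero).le_length (w := pairWord x c.toList)
  simp only [IsDrift, forall_partAt_toList, exists_partAt_toList, rowBit_add_four, rowBit_zero,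
    TargetArena.isDriftPartition_iff, Fin.val_fin_lt]
  refine and_congr_left fun _ => ⟨fun h i => ?_, fun h i _ hi => ?_⟩
  · obtain ⟨u, hu⟩ := h i (i.is_le.trans hk.2) i.is_le
    exact ⟨u, Fin.ext hu⟩
  · obtain ⟨u, hu⟩ := h ⟨i, Nat.lt_succ_of_le hi⟩
    exact ⟨u, congrArg Fin.val hu⟩

lemma isPath_toList :
    IsPath (pairWord x c.toList) ↔ x.arena.IsSimplePathToTarget x.v c.path := by
  simp only [IsPath, forall_pathAt_toList, exists_pathAt_toList, rowBit_add_four, rowBit_three,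
    rowBit_one, TargetArena.isSimplePathToTarget_iff_getElem?, Fin.val_inj]

lemma isCertified_toList : IsCertified (pairWord x c.toList) ↔ c.IsValid x.arena x.v x.W := by
  have hk := (numberAt_pairWord.2 c.toList_zero).le_length (w := pairWord x c.toList)
  have last (u : Fin x.n) : (c.part u : ℕ) = c.k ↔ u ∈ layer c.part (Fin.last c.k) := by
    rw [mem_layer, Fin.ext_iff, Fin.val_last]
  have below (u : Fin x.n) : (c.part u : ℕ) < c.k ↔ u ∈ layersBelow c.part (Fin.last c.k) := by
    rw [mem_layersBelow, Fin.lt_def, Fin.val_last]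
  have path : (∀ (b : ℕ) (q : Fin x.n), c.path[b]? = some q → q ∈ layer c.part (Fin.last c.k)) ↔
      ∀ u ∈ c.path, u ∈ layer c.part (Fin.last c.k) := by
    simp only [List.mem_iff_getElem?, forall_exists_index]
    exact forall_comm
  have exists_k (P : ℕ → Prop) : (∃ k ≤ (pairWord x c.toList).length, c.k = k ∧ P k) ↔ P c.k :=
    ⟨fun ⟨_, _, h, hP⟩ => h ▸ hP, fun hP => ⟨c.k, hk.2, rfl, hP⟩⟩
  simp only [IsCertified, isUnary_pairWord, true_and, isCandidate_toList]
  rw [exists_k]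
  simp only [isDrift_toList, isPath_toList, forall_pathAt_toList, partAt_toList,
    forall_partAt_toList, rowBit_one, rowBit_two, last, below, path]
  exact ⟨fun ⟨h₁, h₂, h₃, h₄, h₅⟩ => ⟨h₁, h₂, h₃, h₄, h₅⟩,
    fun ⟨h₁, h₂, h₃, h₄, h₅⟩ => ⟨h₁, h₂, h₃, h₄, h₅⟩⟩

lemma isCertified_iff_exists {y : List (Option Bool)} :
    IsCertified (x.encode.map Sum.inl ++ y.map Sum.inr) ↔
      ∃ c : Certificate (Fin x.n), y = c.encode ∧ c.IsValid x.arena x.v x.W := by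
  constructor
  · intro h
    obtain ⟨l, rfl⟩ := exists_eq_flatten_of_isUnary h.1
    obtain ⟨k, -, hk, -⟩ := h.2
    obtain ⟨c, rfl⟩ := exists_eq_toList hk
    exact ⟨c, c.encode_eq.symm, isCertified_toList.1 h⟩
  · rintro ⟨c, rfl, hc⟩
    rw [c.encode_eq]
    exact isCertified_toList.2 hc

end PairLetter

/-! ### Bounded search -/

section BoundedSearch

variable {Γ Δ : Type}

/-- The words of length at most `N` over a list of letters, the search space for certificates. -/
def wordsUpTo (letters : List Δ) (N : ℕ) : List (List Δ) :=
  Nat.rec [[]] (fun _ L => [] :: L.flatMap fun y => letters.map (· :: y)) N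

lemma mem_wordsUpTo {letters : List Δ} (h : ∀ a, a ∈ letters) {N : ℕ} {y : List Δ} :
    y ∈ wordsUpTo letters N ↔ y.length ≤ N := by
  induction N generalizing y with
  | zero => simp [wordsUpTo]
  | succ N ih =>
    change y ∈ [] :: ((wordsUpTo letters N).flatMap fun y => letters.map (· :: y)) ↔ _
    cases y with
    | nil => simp
    | cons a y => simp [ih, h]

lemma primrec_wordsUpTo [Primcodable Δ] (letters : List Δ) : Primrec (wordsUpTo letters) := by
  refine Primrec.nat_rec₁ (f := fun _ L => [] :: L.flatMap fun y => letters.map (· :: y)) [[]]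
    (Primrec.list_cons.comp (Primrec.const _) (Primrec.list_flatMap Primrec.snd ?_))
  exact Primrec.list_map (Primrec.const _)
    (Primrec.list_cons.comp Primrec.snd (Primrec.snd.comp Primrec.fst))

lemma WordFormula.primrecPred_exists_le [Finite Γ] [Primcodable Γ] [Finite Δ] [Primcodable Δ]
    (φ : WordFormula (Γ ⊕ Δ) 0) {b : ℕ → ℕ} (hb : Primrec b) :
    PrimrecPred fun w : List Γ => ∃ y : List Δ, y.length ≤ b w.length ∧
      φ.Eval (w.map Sum.inl ++ y.map Sum.inr) Fin.elim0 := by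
  obtain ⟨letters, -, mem_letters⟩ := Finite.exists_univ_list Δ
  have eval : PrimrecRel fun (y : List Δ) (w : List Γ) =>
      φ.Eval (w.map Sum.inl ++ y.map Sum.inr) Fin.elim0 := by
    refine φ.primrecPred_eval.comp (f := fun q : List Δ × List Γ =>
      (q.2.map Sum.inl ++ q.1.map Sum.inr, Fin.elim0)) (Primrec.pair ?_ (Primrec.const _))
    exact Primrec.list_append.comp
      (Primrec.list_map Primrec.snd (Primrec.sumInl.comp Primrec.snd))
      (Primrec.list_map Primrec.fst (Primrec.sumInr.comp Primrec.snd))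
  have search := eval.exists_mem_list.comp
    ((primrec_wordsUpTo letters).comp (hb.comp Primrec.list_length)) Primrec.id
  exact search.of_eq fun w => by simp only [mem_wordsUpTo mem_letters, id]

end BoundedSearch

/-! ### The complexity of the never-worse relation -/

lemma NWRInstance.n_le_length_encode (x : NWRInstance) : x.n ≤ x.encode.length :=
  calc x.n = PairLetter.numRows (PairLetter.pairWord x []) :=
        (PairLetter.numRows_pairWord x []).symm
    _ ≤ (PairLetter.pairWord x []).length := List.countP_le_length
    _ = x.encode.length := by simp [PairLetter.pairWord]

lemma Certificate.IsValid.length_encode_le {n : ℕ} {c : Certificate (Fin n)}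
    {A : TargetArena (Fin n)} {v : Fin n} {W : Set (Fin n)} (hc : c.IsValid A v W) :
    c.encode.length ≤ (2 * n + 1) * (n + 1) := by
  have hk : c.k + 1 ≤ n := by
    simpa using Fintype.card_le_of_surjective _ hc.drift.surjective
  have hπ : c.path.length ≤ n := by simpa using hc.path_ok.simple.length_le_card
  have le_n : ∀ m ∈ c.toList, m ≤ n := by
    intro m hm
    rw [toList, List.cons_append, List.mem_cons, List.mem_append, List.mem_ofFn,
      List.mem_map] at hm
    rcases hm with rfl | ⟨u, rfl⟩ | ⟨u, -, rfl⟩ <;> lia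
  calc c.encode.length = (c.toList.map fun m => m + 1).sum := by
        simp [encode_eq, List.length_flatten, Function.comp_def, unaryWord]
    _ ≤ c.toList.length * (n + 1) := by
        refine (List.sum_le_card_nsmul _ (n + 1) ?_).trans (by simp)
        simpa using le_n
    _ ≤ (2 * n + 1) * (n + 1) := by
        gcongr
        simp only [toList, List.length_append, List.length_cons, List.length_ofFn,
          List.length_map]
        lia

lemma notMem_NWRProblem_iff (x : NWRInstance) : x ∉ NWRProblem ↔
    ∃ c : Certificate (Fin x.n), c.IsValid x.arena x.v x.W := by
  have : Nonempty x.arena.VN := x.VN_nonempty.to_subtype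
  exact ⟨TargetArena.exists_isValid_of_not_neverWorse x.W_nonempty,
    fun ⟨_, hc⟩ => TargetArena.not_neverWorse_of_isValid hc⟩

lemma notMem_NWRProblem_iff_isCertified (x : NWRInstance) : x ∉ NWRProblem ↔
    ∃ y : List (Option Bool), y.length ≤ (2 * x.encode.length + 1) * (x.encode.length + 1) ∧
      PairLetter.IsCertified (x.encode.map Sum.inl ++ y.map Sum.inr) := by
  simp only [notMem_NWRProblem_iff, PairLetter.isCertified_iff_exists]
  constructor
  · rintro ⟨c, hc⟩
    have hn := x.n_le_length_encode
    exact ⟨c.encode, hc.length_encode_le.trans (by gcongr), c, rfl, hc⟩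
  · rintro ⟨_, -, c, -, hc⟩
    exact ⟨c, hc⟩

lemma decidableProblem_NWRProblem : DecidableProblem NWRInstance.encode NWRProblem := by
  obtain ⟨φ, hφ⟩ := PairLetter.exists_wordFormula
  have hb : Primrec fun m : ℕ => (2 * m + 1) * (m + 1) :=
    Primrec.nat_mul.comp
      (Primrec.succ.comp (Primrec.nat_mul.comp (Primrec.const 2) Primrec.id)) Primrec.succ
  obtain ⟨_, hf⟩ := (φ.primrecPred_exists_le hb).not
  refine ⟨_, hf.to_comp, fun x => ?_⟩
  rw [decide_eq_true_iff, ← not_iff_not, notMem_NWRProblem_iff_isCertified, not_not]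
  simp only [hφ]

lemma inPolyTime_certificateCheck : InPolyTime encodeWithCertificate CertificateCheck := by
  obtain ⟨φ, hφ⟩ := PairLetter.exists_wordFormula
  refine φ.inPolyTime fun ⟨x, c⟩ => ?_
  rw [hφ, PairLetter.encodeWithCertificate_eq, PairLetter.isCertified_toList]
  rfl

lemma inCoNP_NWRProblem : InCoNP NWRInstance.encode NWRProblem := by
  obtain ⟨φ, hφ⟩ := PairLetter.exists_wordFormula
  refine ⟨Option Bool, inferInstance,
    {a | PairLetter.IsCertified (encodeWithWord NWRInstance.encode a)},
    (2 * .X + 1) * (.X + 1), φ.inPolyTime fun a => (hφ _).symm, fun x => ?_⟩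
  rw [Set.mem_compl_iff, notMem_NWRProblem_iff_isCertified]
  simp only [Polynomial.eval_mul, Polynomial.eval_add, Polynomial.eval_ofNat, Polynomial.eval_X,
    Polynomial.eval_one]
  rfl

end

theorem mainTheorem5 :
    -- deciding whether `v ⊴ W` holds is decidable
    DecidableProblem NWRInstance.encode NWRProblem ∧
    -- and in coNP
    InCoNP NWRInstance.encode NWRProblem ∧
    -- the certificates of non-membership: drift partitions with simple paths
    ((∀ x : NWRInstance, x ∉ NWRProblem ↔
        ∃ c : Certificate (Fin x.n), c.IsValid x.arena x.v x.W) ∧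
      (∃ p : Polynomial ℕ, ∀ (x : NWRInstance) (c : Certificate (Fin x.n)),
        c.IsValid x.arena x.v x.W → c.encode.length ≤ p.eval x.encode.length) ∧
      InPolyTime encodeWithCertificate CertificateCheck) := by
  refine ⟨decidableProblem_NWRProblem, inCoNP_NWRProblem, notMem_NWRProblem_iff,
    ⟨(2 * .X + 1) * (.X + 1), fun x c hc => hc.length_encode_le.trans ?_⟩,
    inPolyTime_certificateCheck⟩
  have hn := x.n_le_length_encode
  simp only [Polynomial.eval_mul, Polynomial.eval_add, Polynomial.eval_ofNat, Polynomial.eval_X,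
    Polynomial.eval_one]
  gcongr
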